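/- A \emph{generalized Baumslag--Solitar (GBS) group} is a finitely generated group $G$ acting minimally, by simplicial automorphisms without inversions, on a simplicial tree with all vertex and edge stabilizers infinite cyclic (a \emph{GBS tree} of $G$). Let $G$ be a non-elementary GBS group, i.e. one not isomorphic to $\mathbb Z$, $\mathbb Z^2$ or the fundamental group of the Klein bottle. Let $\mathcal D$ be the deformation space of a GBS tree $T_0$ of $G$: the class of all minimal simplicial $G$-trees without inversions, with $G$-invariant positive edge lengths, whose elliptic subgroups (subgroups fixing a point) are those of $T_0$. For $T\in\mathcal D$ let $\|g\|_T=\inf_{x\in T} d_T(x,gx)$ be the translation length. An element is loxodromic if it fixes no point of $T_0$ (equivalently, of any tree of $\mathcal D$), and $\mathrm{Axis}_T(g)$ is the set of points where this infimum is attained. For $N\ge 1$, we say that $a,b\in G$ \emph{admit $N$ common consecutive fundamental domains up to translation in $T$} if there are $h\in G$ and, with $c=hbh^{-1}$, a point $v\in \mathrm{Axis}_T(a)\cap\mathrm{Axis}_T(c)$ such that $[v,a^Nv]=[v,c^Nv]$. The conjugacy class of $g$ is \emph{pseudo-periodic} for $\Phi\in\mathrm{Out}(G)$ if for some $T\in\mathcal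 D$ and some $\psi\in\Phi$ the sequence $(\|\psi^n(g)\|_T)_{n\ge 0}$ is bounded. Proposition. Let $\phi\in\mathrm{Aut}(G)$ and let $g\in G$ be loxodromic. The following conditions are equivalent: (i) the conjugacy class of $g$ is pseudo-periodic for the outer class $\Phi=[\phi]$; (ii) for every $T\in\mathcal D$ and every $N\ge 1$ there exist distinct $n,m\in\mathbb N$ such that $\phi^n(g)$ and $\phi^m(g)$ admit $N$ common consecutive fundamental domains up to translation in $T$; (iii) for every $N\ge 1$ there exists $m>0$ such that for every $S\in\mathcal D$, $g$ and $\phi^m(g)$ admit $N$ common consecutive fundamental domains up to translation in $S$; (iv) for every $T\in\mathcal D$ the sequence $(\|\phi^n(g)\|_T)_{n\to-\infty}$ is bounded. -/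

import Mathlib

universe u

/-- The group `ℤ ⋊ ℤ`, the generator of the second factor acting on the first by inversion:
the fundamental group `⟨a, t | t a t⁻¹ = a⁻¹⟩` of the Klein bottle. -/
abbrev KleinBottleGroup : Type :=
  SemidirectProduct (Multiplicative ℤ) (Multiplicative ℤ)
    (zpowersHom (MulAut (Multiplicative ℤ)) (MulEquiv.inv (Multiplicative ℤ)))

/-- The group `Out(G)` of outer automorphisms (as a set of classes). -/
abbrev OutClasses (G : Type u) [Group G] : Type u :=
  MulAut G ⧸ (MulAut.conj : G →* MulAut G).range

/-- A group is elementary (as a generalized Baumslag-Solitar group) if it is isomorphic to `ℤ`,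
to `ℤ²`, or to the Klein bottle group. -/
def IsElementaryGBS (G : Type u) [Group G] : Prop :=
  Nonempty (G ≃* Multiplicative ℤ) ∨ Nonempty (G ≃* Multiplicative (ℤ × ℤ)) ∨
    Nonempty (G ≃* KleinBottleGroup)

/-- A metric `G`-tree: a simplicial tree with positive edge lengths, on which `G` acts by
length-preserving simplicial automorphisms, without inversions. The values of `len` on pairs of
non-adjacent vertices are irrelevant. -/
structure MetricGTree (G : Type u) [Group G] where
  V : Type u
  [action : MulAction G V]
  graph : SimpleGraph V
  isTree : graph.IsTree
  adj_smul : ∀ (g : G) (v w : V), graph.Adj v w → graph.Adj (g • v) (g • w)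
  no_inversion : ∀ (g : G) (v w : V), graph.Adj v w → ¬ (g • v = w ∧ g • w = v)
  len : V → V → ℝ
  len_pos : ∀ v w : V, graph.Adj v w → 0 < len v w
  len_symm : ∀ v w : V, graph.Adj v w → len w v = len v w
  len_smul : ∀ (g : G) (v w : V), graph.Adj v w → len (g • v) (g • w) = len v w

attribute [instance] MetricGTree.action

namespace MetricGTree

variable {G : Type u} [Group G]

/-- The unique edge path without backtracking from `v` to `w`. -/
noncomputable def geodesic (T : MetricGTree G) (v w : T.V) : T.graph.Walk v w :=
  (T.isTree.existsUnique_path v w).choose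

theorem geodesic_isPath (T : MetricGTree G) (v w : T.V) : (T.geodesic v w).IsPath :=
  (T.isTree.existsUnique_path v w).choose_spec.1

/-- The segment `[v, w]`, given by its set of vertices. -/
def segment (T : MetricGTree G) (v w : T.V) : Set T.V :=
  {x | x ∈ (T.geodesic v w).support}

/-- The distance between two vertices: the sum of the lengths of the edges of `[v, w]`. -/
noncomputable def dist (T : MetricGTree G) (v w : T.V) : ℝ :=
  ((T.geodesic v w).darts.map fun d => T.len d.fst d.snd).sum

/-- The translation length `‖g‖_T`. As there are no inversions, the infimum of the displacement
over all points of the tree is its infimum over the vertices. -/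
noncomputable def translationLength (T : MetricGTree G) (g : G) : ℝ :=
  ⨅ v : T.V, T.dist v (g • v)

/-- The characteristic set of `g`: the vertices whose displacement by `g` is minimal. For a
loxodromic element, these are the vertices of its axis. -/
def axis (T : MetricGTree G) (g : G) : Set T.V :=
  {v | T.dist v (g • v) = T.translationLength g}

/-- A subgroup is elliptic if it fixes a point of the tree; as there are no inversions, it then
fixes a vertex. -/
def IsElliptic (T : MetricGTree G) (H : Subgroup G) : Prop :=
  ∃ v : T.V, ∀ h ∈ H, h • v = v

/-- An element is loxodromic if it fixes no point of the tree (equivalently, no vertex). -/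
def IsLoxodromic (T : MetricGTree G) (g : G) : Prop :=
  ∀ v : T.V, g • v ≠ v

/-- There is no nonempty proper `G`-invariant subtree. -/
def IsMinimal (T : MetricGTree G) : Prop :=
  ∀ W : Set T.V, W.Nonempty → (∀ (g : G), ∀ v ∈ W, g • v ∈ W) →
    (T.graph.induce W).Connected → W = Set.univ

/-- A GBS tree: a minimal tree all of whose vertex and edge stabilizers are infinite cyclic. -/
def IsGBSTree (T : MetricGTree G) : Prop :=
  T.IsMinimal ∧
  (∀ v : T.V, IsCyclic (MulAction.stabilizer G v) ∧ Infinite (MulAction.stabilizer G v)) ∧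
  (∀ v w : T.V, T.graph.Adj v w →
    IsCyclic (MulAction.stabilizer G v ⊓ MulAction.stabilizer G w : Subgroup G) ∧
    Infinite (MulAction.stabilizer G v ⊓ MulAction.stabilizer G w : Subgroup G))

/-- The deformation space of `T₀`: all minimal metric `G`-trees with the same elliptic subgroups
as `T₀`. -/
def deformationSpace (T₀ : MetricGTree G) : Set (MetricGTree G) :=
  {T | T.IsMinimal ∧ ∀ H : Subgroup G, T.IsElliptic H ↔ T₀.IsElliptic H}

/-- `a` and `b` admit `N` common consecutive fundamental domains up to translation: for some
conjugate `c` of `b` there is a point `v` on the axes of `a` and `c` with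
`[v, a ^ N v] = [v, c ^ N v]`. As there are no inversions, `v` may be taken to be a vertex (if `v`
is interior to an edge, the endpoint of this edge lying behind `v` has the same property). -/
def ShareFundamentalDomains (T : MetricGTree G) (N : ℕ) (a b : G) : Prop :=
  ∃ h : G, ∃ v : T.V, v ∈ T.axis a ∧ v ∈ T.axis (h * b * h⁻¹) ∧
    T.segment v (a ^ N • v) = T.segment v ((h * b * h⁻¹) ^ N • v)

/-- The conjugacy class `c` is pseudo-periodic for the outer automorphism `Φ`, with respect to the
set of trees `D`: for some tree `T ∈ D`, some `ψ ∈ Φ` (and some `a ∈ c`), the sequence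
`‖ψ ^ n (a)‖_T`, `n ≥ 0`, is bounded. -/
def IsPseudoPeriodic (D : Set (MetricGTree G)) (Φ : OutClasses G) (c : ConjClasses G) : Prop :=
  ∃ T ∈ D, ∃ ψ : MulAut G, (QuotientGroup.mk ψ : OutClasses G) = Φ ∧
    ∃ a : G, ConjClasses.mk a = c ∧
      ∃ B : ℝ, ∀ n : ℕ, T.translationLength ((ψ ^ n) a) ≤ B

end MetricGTree

/-! Condition (iii) is the hub; three facts tie the others to it.

Finiteness. All vertex stabilizers of a tree in the deformation space are cyclic and contain a
nonzero power of one fixed element `e`. As `G` is finitely generated, the tree has finitely many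
edge orbits and is locally finite, hence has finitely many orbits of pairs of vertices at bounded
distance. Given loxodromic elements `a n` of bounded translation length and points `v n` on their
axes, the pigeonhole principle on the pairs `(v n, a n ^ N • v n)` gives two elements sharing `N`
fundamental domains (`exists_shareFundamentalDomains`).

Rigidity. For `N ≥ 2`, sharing `N` domains does not depend on the tree
(`ShareFundamentalDomains.of_isElliptic`). If `a` and `c` agree along `N` domains from `v`, then
`a⁻¹ * c` fixes `a ^ i • v` for `i < N`, so its conjugates by the `a ^ (-i)` fix `v`. The stabilizer
of `v` fixes some `p` in the other tree `S`, so there `a⁻¹ * c` fixes `p` and `a ^ (N - 1) • p`,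
hence also the part of the axis of `a` between their projections.

Invariance. Elliptic elements are exactly those commensurable with all their conjugates: a
loxodromic one with this property has an invariant axis, so the tree is a line and `G` is elementary
(`exists_smul_eq`). Automorphisms therefore preserve ellipticity, and twisting the action by one
preserves the deformation space.

Bounded forward or backward iterates thus give two iterates sharing domains in one tree; rigidity
and a twist turn this into `g` and `φ ^ p` of `g` sharing in every tree. Conversely, applying (iii)
to the twists of `T` by all `φ ^ k` makes the translation length of `φ ^ k` of `g` periodic in `k :
ℤ`, hence bounded in both directions. -/

/-! ### Geodesics and medians in simplicial trees -/

namespace SimpleGraph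

variable {V : Type*} {Γ : SimpleGraph V}

/-- On a tree, a walk of minimal length is determined by its endpoints. -/
theorem IsTree.walk_eq_of_length_eq_dist (h : Γ.IsTree) {v w : V} (p q : Γ.Walk v w)
    (hp : p.length = Γ.dist v w) (hq : q.length = Γ.dist v w) : p = q :=
  (h.existsUnique_path v w).unique (p.isPath_of_length_eq_dist hp) (q.isPath_of_length_eq_dist hq)

theorem IsTree.eq_of_dist_add_one (h : Γ.IsTree) {v w u u' : V} (hu : Γ.Adj v u)
    (hu' : Γ.Adj v u') (hd : Γ.dist u w + 1 = Γ.dist v w) (hd' : Γ.dist u' w + 1 = Γ.dist v w) :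
    u = u' := by
  obtain ⟨p, hp⟩ := h.connected.exists_walk_length_eq_dist u w
  obtain ⟨p', hp'⟩ := h.connected.exists_walk_length_eq_dist u' w
  have := h.walk_eq_of_length_eq_dist (Walk.cons hu p) (Walk.cons hu' p')
    (by simp [hp, hd]) (by simp [hp', hd'])
  simpa using congrArg Walk.snd this

theorem Connected.exists_adj_dist_add_one (h : Γ.Connected) {v w : V} (hvw : v ≠ w) :
    ∃ u, Γ.Adj v u ∧ Γ.dist u w + 1 = Γ.dist v w := by
  obtain ⟨p, hp⟩ := h.exists_walk_length_eq_dist v w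
  cases p with
  | nil => exact absurd rfl hvw
  | @cons _ u _ hu q =>
    refine ⟨u, hu, ?_⟩
    have h1 := dist_le q
    have h2 := h.dist_triangle (u := v) (v := u) (w := w)
    have h3 := dist_eq_one_iff_adj.2 hu
    simp only [Walk.length_cons] at hp
    omega

theorem IsTree.eq_of_dist_eq (h : Γ.IsTree) {x z y y' : V}
    (hy : Γ.dist x y + Γ.dist y z = Γ.dist x z) (hy' : Γ.dist x y' + Γ.dist y' z = Γ.dist x z)
    (hd : Γ.dist x y = Γ.dist x y') : y = y' := by
  obtain ⟨p, hp⟩ := h.connected.exists_walk_length_eq_dist x y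
  obtain ⟨q, hq⟩ := h.connected.exists_walk_length_eq_dist y z
  obtain ⟨p', hp'⟩ := h.connected.exists_walk_length_eq_dist x y'
  obtain ⟨q', hq'⟩ := h.connected.exists_walk_length_eq_dist y' z
  have := h.walk_eq_of_length_eq_dist (p.append q) (p'.append q')
    (by simp [hp, hq, hy]) (by simp [hp', hq', hy'])
  have h2 := congrArg (fun w : Γ.Walk x z => w.getVert p.length) this
  simpa [Walk.getVert_append, hp, hp', hd] using h2

/-- Medians exist in trees. -/
theorem IsTree.exists_median (h : Γ.IsTree) (x y z : V) :
    ∃ m, Γ.dist x m + Γ.dist m y = Γ.dist x y ∧ Γ.dist y m + Γ.dist m z = Γ.dist y z ∧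
      Γ.dist x m + Γ.dist m z = Γ.dist x z := by
  obtain ⟨p⟩ := h.connected.preconnected z y
  induction p with
  | @nil y => exact ⟨y, by rw [dist_self, add_zero], by rw [dist_self], by rw [dist_self, add_zero]⟩
  | @cons z' z y hz p ih =>
    obtain ⟨m, h1, h2, h3⟩ := ih
    have tri := fun a b c => h.connected.dist_triangle (u := a) (v := b) (w := c)
    have cm := fun a b => dist_comm (G := Γ) (u := a) (v := b)
    have hzz := dist_eq_one_iff_adj.2 hz
    -- When `m ≠ z`, geodesics from `z` to `x` and to `y` start with the edge towards `m`; so if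
    -- `z'` is nearer to `x` or `y`, it lies on that edge, and `m` remains the median.
    have key : m ≠ z → (Γ.dist x z = Γ.dist x z' + 1 ∨ Γ.dist y z = Γ.dist y z' + 1) →
        Γ.dist m z = Γ.dist m z' + 1 := by
      intro hne hor
      obtain ⟨u, hu, hud⟩ := h.connected.exists_adj_dist_add_one hne.symm
      have e1 := dist_eq_one_iff_adj.2 hu
      have hu' : u = z' := by
        rcases hor with h' | h'
        · refine h.eq_of_dist_add_one (w := x) hu hz.symm ?_ ?_
          · have := tri u m x; have := tri z u x
            have := cm x m; have := cm x z; have := cm m z; omega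
          · rw [cm z', cm z]; omega
        · refine h.eq_of_dist_add_one (w := y) hu hz.symm ?_ ?_
          · have := tri u m y; have := tri z u y
            have := cm y m; have := cm y z; have := cm m z; omega
          · rw [cm z', cm z]; omega
      subst hu'
      rw [cm m, cm m]; omega
    have dx := h.dist_eq_dist_add_one_of_adj x hz
    have dy := h.dist_eq_dist_add_one_of_adj y hz
    have t1 := tri m z z'
    have t2 := tri x m z'
    have t3 := tri y m z'
    have t4 := tri x z' y
    rw [cm z z'] at t1
    rw [cm z' y] at t4
    by_cases hm : m = z
    · subst hm
      rw [cm m y] at h1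
      rw [cm m z'] at *
      rcases dx with dx | dx <;> rcases dy with dy | dy
      · exact ⟨m, by rw [cm m y]; omega, by rw [cm m z']; omega, by rw [cm m z']; omega⟩
      · exact ⟨z', by rw [cm z' y]; omega, by rw [dist_self]; omega, by rw [dist_self]; omega⟩
      · exact ⟨z', by rw [cm z' y]; omega, by rw [dist_self]; omega, by rw [dist_self]; omega⟩
      · exfalso; omega
    · have key := key hm
      refine ⟨m, h1, ?_, ?_⟩
      · rcases dx with dx | dx <;> rcases dy with dy | dy <;> omega
      · rcases dx with dx | dx <;> rcases dy with dy | dy <;> omega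

/-- Local geodesics in trees are geodesics. -/
theorem IsTree.dist_eq_of_overlap (h : Γ.IsTree) {x y z w : V}
    (h1 : Γ.dist x y + Γ.dist y z = Γ.dist x z) (h2 : Γ.dist y z + Γ.dist z w = Γ.dist y w)
    (hne : y ≠ z) : Γ.dist x z + Γ.dist z w = Γ.dist x w := by
  obtain ⟨m, a1, a2, a3⟩ := h.exists_median x z w
  have tri := fun a b c => h.connected.dist_triangle (u := a) (v := b) (w := c)
  have cm := fun a b => dist_comm (G := Γ) (u := a) (v := b)
  -- If `m ≠ z`, the first edge from `z` towards `m` leads both to `w` and to `x`, hence to `y`: the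
  -- path from `y` to `w` would backtrack at `z`.
  by_cases hm : m = z
  · subst hm; exact a3
  exfalso
  obtain ⟨u, hu, hud⟩ := h.connected.exists_adj_dist_add_one (Ne.symm hm)
  obtain ⟨u', hu', hud'⟩ := h.connected.exists_adj_dist_add_one hne.symm
  have e1 := dist_eq_one_iff_adj.2 hu
  have e2 := dist_eq_one_iff_adj.2 hu'
  have c1 := cm u x
  have c2 := cm z x
  have c3 := cm z y
  have c4 := cm z m
  have c5 := cm x m
  have c6 := cm u y
  have c7 := cm y x
  have : u = u' := by
    refine h.eq_of_dist_add_one (w := x) hu hu' ?_ ?_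
    · have := tri u m x; have := tri z u x; omega
    · have := tri u' y x; have := tri z u' x; omega
  subst this
  have := tri y u w
  have := tri u m w
  omega

end SimpleGraph

/-! ### Metric distance and existence of axes -/

namespace MetricGTree

variable {G : Type u} [Group G] (T : MetricGTree G)

/-- The automorphism of the underlying graph defined by a group element. -/
def smulHom (g : G) : T.graph →g T.graph where
  toFun v := g • v
  map_rel' h := T.adj_smul g _ _ h

theorem graphDist_smul (g : G) (v w : T.V) :
    T.graph.dist (g • v) (g • w) = T.graph.dist v w := by
  have key : ∀ (g : G) (v w : T.V), T.graph.dist (g • v) (g • w) ≤ T.graph.dist v w := by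
    intro g v w
    obtain ⟨p, hp⟩ := T.isTree.connected.exists_walk_length_eq_dist v w
    rw [← hp, ← SimpleGraph.Walk.length_map (T.smulHom g) p]
    exact SimpleGraph.dist_le (p.map (T.smulHom g))
  refine le_antisymm (key g v w) ?_
  simpa using key g⁻¹ (g • v) (g • w)

theorem geodesic_length (v w : T.V) : (T.geodesic v w).length = T.graph.dist v w := by
  obtain ⟨p, hp, hl⟩ := T.isTree.connected.exists_path_of_dist v w
  rw [← hl, (T.isTree.existsUnique_path v w).unique (T.geodesic_isPath v w) hp]

theorem dist_eq_sum {v w : T.V} (p : T.graph.Walk v w) (hp : p.length = T.graph.dist v w) :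
    T.dist v w = (p.darts.map fun d => T.len d.fst d.snd).sum := by
  rw [T.isTree.walk_eq_of_length_eq_dist p (T.geodesic v w) hp (T.geodesic_length v w)]
  rfl

@[simp]
theorem dist_self (v : T.V) : T.dist v v = 0 := by
  rw [T.dist_eq_sum SimpleGraph.Walk.nil (by simp)]
  simp

theorem dist_adj {v w : T.V} (h : T.graph.Adj v w) : T.dist v w = T.len v w := by
  rw [T.dist_eq_sum (SimpleGraph.Walk.cons h SimpleGraph.Walk.nil)
    (by simp [SimpleGraph.dist_eq_one_iff_adj.2 h])]
  simp

theorem dist_add {x y z : T.V}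
    (h : T.graph.dist x y + T.graph.dist y z = T.graph.dist x z) :
    T.dist x y + T.dist y z = T.dist x z := by
  rw [T.dist_eq_sum ((T.geodesic x y).append (T.geodesic y z))
    (by simp [geodesic_length, h])]
  simp [dist]

theorem dist_comm (v w : T.V) : T.dist v w = T.dist w v := by
  rw [T.dist_eq_sum (T.geodesic w v).reverse
    (by simp [geodesic_length, SimpleGraph.dist_comm])]
  rw [SimpleGraph.Walk.darts_reverse, List.map_reverse, List.sum_reverse, List.map_map, dist]
  congr 1
  refine List.map_congr_left fun d _ => ?_
  exact T.len_symm _ _ d.adj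

theorem dist_smul (g : G) (v w : T.V) : T.dist (g • v) (g • w) = T.dist v w := by
  have := T.dist_eq_sum ((T.geodesic v w).map (T.smulHom g))
    (by simp [geodesic_length]; exact (T.graphDist_smul g v w).symm)
  refine this.trans ?_
  rw [SimpleGraph.Walk.darts_map, List.map_map, dist]
  congr 1
  refine List.map_congr_left fun d _ => ?_
  exact T.len_smul _ _ _ d.adj

theorem dist_nonneg (v w : T.V) : 0 ≤ T.dist v w := by
  refine List.sum_nonneg fun x hx => ?_
  obtain ⟨d, -, rfl⟩ := List.mem_map.1 hx
  exact (T.len_pos _ _ d.adj).le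

theorem mul_graphDist_le {ε : ℝ} (hε : ∀ v w, T.graph.Adj v w → ε ≤ T.len v w) (v w : T.V) :
    ε * T.graph.dist v w ≤ T.dist v w := by
  have h := List.card_nsmul_le_sum ((T.geodesic v w).darts.map fun d => T.len d.fst d.snd) ε
    (fun x hx => by
      obtain ⟨d, -, rfl⟩ := List.mem_map.1 hx
      exact hε _ _ d.adj)
  simp only [List.length_map, SimpleGraph.Walk.length_darts, geodesic_length, nsmul_eq_mul] at h
  rw [mul_comm]
  exact h

theorem dist_pos {v w : T.V} (h : v ≠ w) : 0 < T.dist v w := by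
  obtain ⟨u, hu, hd⟩ := T.isTree.connected.exists_adj_dist_add_one h
  have h1 := SimpleGraph.dist_eq_one_iff_adj.2 hu
  rw [← T.dist_add (y := u) (by omega), T.dist_adj hu]
  have := T.len_pos _ _ hu
  have := T.dist_nonneg u w
  linarith

theorem dist_triangle (x y z : T.V) : T.dist x z ≤ T.dist x y + T.dist y z := by
  obtain ⟨m, h1, h2, h3⟩ := T.isTree.exists_median x y z
  rw [← T.dist_add h1, ← T.dist_add h2, ← T.dist_add h3, T.dist_comm m y]
  have := T.dist_nonneg y m
  linarith

theorem dist_add_of_mem_segment {x v w : T.V} (h : x ∈ T.segment v w) :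
    T.graph.dist v x + T.graph.dist x w = T.graph.dist v w := by
  classical
  have h' : x ∈ (T.geodesic v w).support := h
  have e := congrArg SimpleGraph.Walk.length ((T.geodesic v w).take_spec h')
  rw [SimpleGraph.Walk.length_append, geodesic_length] at e
  have h1 := SimpleGraph.dist_le ((T.geodesic v w).takeUntil x h')
  have h2 := SimpleGraph.dist_le ((T.geodesic v w).dropUntil x h')
  have h3 := T.isTree.connected.dist_triangle (u := v) (v := x) (w := w)
  omega

theorem segment_eq_iff {v w w' : T.V} : T.segment v w = T.segment v w' ↔ w = w' := by
  refine ⟨fun h => ?_, fun h => h ▸ rfl⟩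
  have h1 : w ∈ T.segment v w' := h ▸ (T.geodesic v w).end_mem_support
  have h2 : w' ∈ T.segment v w := h ▸ (T.geodesic v w').end_mem_support
  have h1 := T.dist_add_of_mem_segment h1
  have h2 := T.dist_add_of_mem_segment h2
  refine (T.isTree.connected.dist_eq_zero_iff).1 ?_
  omega

/-- The fixed point set of a group element is convex. -/
theorem smul_eq_of_between {g : G} {x y z : T.V} (hx : g • x = x) (hz : g • z = z)
    (h : T.graph.dist x y + T.graph.dist y z = T.graph.dist x z) : g • y = y := by
  have h1 := T.graphDist_smul g x y
  have h2 := T.graphDist_smul g y z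
  rw [hx] at h1
  rw [hz] at h2
  exact T.isTree.eq_of_dist_eq (by rw [h1, h2, h]) h h1

/-- `f` is an axis of the loxodromic element `a`: an isometric line on which `a` acts as the
translation by `L > 0`. -/
structure IsAxis (a : G) (L : ℕ) (f : ℤ → T.V) : Prop where
  pos : 0 < L
  dist_eq : ∀ i j, (T.graph.dist (f i) (f j) : ℤ) = |i - j|
  smul_eq : ∀ i, a • f i = f (i + L)

variable {T}

/-- No backtracking at `a • v` means none at any later translate, and local geodesics are geodesics.
-/
theorem graphDist_pow_smul {a : G} {v : T.V} {L : ℕ} (hL : 0 < L)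
    (h1 : T.graph.dist v (a • v) = L) (h2 : T.graph.dist v (a • a • v) = 2 * L) (n : ℕ) :
    T.graph.dist v (a ^ n • v) = n * L := by
  have key : ∀ n : ℕ, T.graph.dist v (a ^ n • v) = n * L ∧
      T.graph.dist v (a ^ (n + 1) • v) = (n + 1) * L := by
    intro n
    induction n with
    | zero => simp [h1]
    | succ n ih =>
      refine ⟨by simpa using ih.2, ?_⟩
      have e1 : T.graph.dist (a ^ n • v) (a ^ (n + 1) • v) = L := by
        rw [pow_succ, mul_smul, graphDist_smul, h1]
      have e2 : T.graph.dist (a ^ (n + 1) • v) (a ^ (n + 1 + 1) • v) = L := by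
        rw [pow_succ a (n + 1), mul_smul, graphDist_smul, h1]
      have e3 : T.graph.dist (a ^ n • v) (a ^ (n + 1 + 1) • v) = 2 * L := by
        rw [pow_succ, pow_succ, mul_assoc, mul_smul, graphDist_smul, mul_smul, h2]
      have := T.isTree.dist_eq_of_overlap (x := v) (y := a ^ n • v) (z := a ^ (n + 1) • v)
        (w := a ^ (n + 1 + 1) • v) (by rw [ih.1, ih.2, e1]; ring) (by rw [e1, e2, e3]; ring)
        (by intro h; rw [← h, SimpleGraph.dist_self] at e1; omega)
      rw [← this, ih.2, e2]; ring
  exact (key n).1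

/-- The line is the union of the translates of `[v, a • v]`. It is parametrized by a 1-Lipschitz map
which attains the full distance between `-(n * L)` and `n * L` for every `n`, so it is isometric in
between. -/
theorem exists_isAxis_of_graphDist {a : G} {v : T.V} {L : ℕ} (hL : 0 < L)
    (h1 : T.graph.dist v (a • v) = L) (h2 : T.graph.dist v (a • a • v) = 2 * L) :
    ∃ f, T.IsAxis a L f ∧ f 0 = v := by
  have hn := graphDist_pow_smul hL h1 h2
  obtain ⟨p, hp⟩ := T.isTree.connected.exists_walk_length_eq_dist v (a • v)
  rw [h1] at hp
  have hLz : (0 : ℤ) < L := by exact_mod_cast hL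
  let f : ℤ → T.V := fun i => a ^ (i / L) • p.getVert (i % L).toNat
  have f0 : f 0 = v := by simp [f]
  have fs : ∀ i, a • f i = f (i + L) := by
    intro i
    have e1 : (i + L) / (L : ℤ) = 1 + i / L := by
      rw [Int.add_ediv_of_dvd_right (dvd_refl _), Int.ediv_self hLz.ne']; ring
    simp only [f, e1, Int.add_emod_right, zpow_add, zpow_one, mul_smul]
  have fl : ∀ i, T.graph.dist (f i) (f (i + 1)) ≤ 1 := by
    intro i
    have hm := Int.emod_nonneg i hLz.ne'
    have hm' := Int.emod_lt_of_pos i hLz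
    have hdm := Int.mul_ediv_add_emod i L
    by_cases hc : i % L + 1 < L
    · have e : (i + 1) / (L : ℤ) = i / L ∧ (i + 1) % (L : ℤ) = i % L + 1 := by
        rw [Int.ediv_emod_unique hLz]; refine ⟨by linarith, by omega, hc⟩
      simp only [f, e.1, e.2, graphDist_smul]
      have : (i % L + 1).toNat = (i % L).toNat + 1 := by omega
      rw [this]
      exact (SimpleGraph.dist_eq_one_iff_adj.2 (p.adj_getVert_succ (by omega))).le
    · have e : (i + 1) / (L : ℤ) = i / L + 1 ∧ (i + 1) % (L : ℤ) = 0 := by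
        rw [Int.ediv_emod_unique hLz]; refine ⟨?_, le_refl _, hLz⟩
        have : i % L = L - 1 := by omega
        linarith
      simp only [f, e.1, e.2, zpow_add, zpow_one, mul_smul, graphDist_smul]
      have e3 : a • p.getVert (0 : ℤ).toNat = p.getVert ((i % L).toNat + 1) := by
        have : (i % L).toNat + 1 = p.length := by omega
        rw [this]; simp
      rw [e3]
      exact (SimpleGraph.dist_eq_one_iff_adj.2 (p.adj_getVert_succ (by omega))).le
  have tri := fun a b c => T.isTree.connected.dist_triangle (u := a) (v := b) (w := c)
  have fl' : ∀ i (n : ℕ), T.graph.dist (f i) (f (i + n)) ≤ n := by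
    intro i n
    induction n with
    | zero => simp
    | succ n ih =>
      have := tri (f i) (f (i + n)) (f (i + (n + 1 : ℕ)))
      have := fl (i + n)
      rw [add_assoc] at this
      push_cast at *
      omega
  have fz : ∀ n : ℤ, f (n * L) = a ^ n • v := by
    intro n
    simp only [f, Int.mul_ediv_cancel _ hLz.ne', Int.mul_emod_left]
    simp
  have fnn : ∀ n : ℕ, T.graph.dist (f (-(n * L))) (f (n * L)) = 2 * n * L := by
    intro n
    rw [← neg_mul, fz, fz, ← graphDist_smul T (a ^ (n : ℤ)), ← mul_smul, ← mul_smul, ← zpow_add,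
      ← zpow_add]
    have := hn (2 * n)
    rw [show (n : ℤ) + -n = 0 by ring, zpow_zero, one_smul,
      show (n : ℤ) + n = ((2 * n : ℕ) : ℤ) by push_cast; ring, zpow_natCast, this]
  have fle : ∀ i j : ℤ, i ≤ j → (T.graph.dist (f i) (f j) : ℤ) = j - i := by
    intro i j hij
    obtain ⟨M, hM1, hM2⟩ : ∃ n : ℕ, -((n : ℤ) * L) ≤ i ∧ j ≤ n * L := by
      refine ⟨i.natAbs + j.natAbs, ?_, ?_⟩ <;> push_cast <;> nlinarith [abs_nonneg i, abs_nonneg j, neg_abs_le i, le_abs_self j]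
    have a1 := fl' (-((M : ℤ) * L)) (i + M * L).toNat
    have a2 := fl' i (j - i).toNat
    have a3 := fl' j (M * L - j).toNat
    rw [show -((M : ℤ) * L) + ((i + M * L).toNat : ℤ) = i by omega] at a1
    rw [show i + ((j - i).toNat : ℤ) = j by omega] at a2
    rw [show j + ((M * L - j).toNat : ℤ) = M * L by omega] at a3
    have a4 := fnn M
    have t1 := tri (f (-((M : ℤ) * L))) (f i) (f j)
    have t2 := tri (f (-((M : ℤ) * L))) (f j) (f (M * L))
    have : (2 * M * L : ℕ) = (M * L : ℤ) + M * L := by push_cast; ring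
    omega
  refine ⟨f, ⟨hL, fun i j => ?_, fs⟩, f0⟩
  rcases le_total i j with h | h
  · rw [fle i j h, abs_of_nonpos (by omega)]; ring
  · rw [SimpleGraph.dist_comm, fle j i h, abs_of_nonneg (by omega)]

/-- Take `v` of minimal displacement. If the path through `v`, `a • v`, `a • a • v` backtracked, the
neighbour of `v` towards `a • v` would be displaced less, or, when it is `a • v` itself, `a` would
invert an edge. -/
theorem IsLoxodromic.exists_isAxis {a : G} (ha : T.IsLoxodromic a) : ∃ L f, T.IsAxis a L f := by
  obtain ⟨v₀⟩ := T.isTree.connected.nonempty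
  obtain ⟨v, hv⟩ : ∃ v, ∀ w, T.graph.dist v (a • v) ≤ T.graph.dist w (a • w) := by
    have : Nonempty T.V := ⟨v₀⟩
    exact ⟨_, fun w => Function.argmin_le (fun v => T.graph.dist v (a • v)) w⟩
  have hL : 0 < T.graph.dist v (a • v) := T.isTree.connected.pos_dist_of_ne (ha v).symm
  have tri := fun a b c => T.isTree.connected.dist_triangle (u := a) (v := b) (w := c)
  have cm := fun a b => SimpleGraph.dist_comm (G := T.graph) (u := a) (v := b)
  obtain ⟨f, hf, -⟩ := exists_isAxis_of_graphDist hL rfl (by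
    obtain ⟨m, m1, m2, m3⟩ := T.isTree.exists_median v (a • v) (a • a • v)
    have e1 := T.graphDist_smul a v (a • v)
    by_cases hm : m = a • v
    · subst hm; omega
    exfalso
    obtain ⟨y, hy, hyd⟩ := T.isTree.connected.exists_adj_dist_add_one (ha v).symm
    have hay := T.adj_smul a _ _ hy
    have hayd := T.graphDist_smul a y (a • v)
    obtain ⟨u, hu, hud⟩ := T.isTree.connected.exists_adj_dist_add_one (Ne.symm hm)
    have u1 := SimpleGraph.dist_eq_one_iff_adj.2 hu
    have y1 := SimpleGraph.dist_eq_one_iff_adj.2 hy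
    have c1 := cm (a • v) m
    have c2 := cm (a • v) v
    have c3 := cm u v
    have c4 := cm m v
    have c5 := cm u (a • v)
    have hu1 : T.graph.dist u v + 1 = T.graph.dist (a • v) v := by
      have := tri u m v; have := tri (a • v) u v; omega
    have hu2 : T.graph.dist u (a • a • v) + 1 = T.graph.dist (a • v) (a • a • v) := by
      have := tri u m (a • a • v); have := tri (a • v) u (a • a • v); omega
    have huy : u = a • y := T.isTree.eq_of_dist_add_one hu hay hu2 (by omega)
    have hmin := hv y
    rw [← huy] at hmin
    by_cases hyv : y = a • v
    · subst hyv
      have : T.graph.dist (a • v) (a • v) = 0 := SimpleGraph.dist_self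
      have hvv : a • a • v = v := by
        rw [← huy]; refine (T.isTree.connected.dist_eq_zero_iff).1 (by omega)
      exact T.no_inversion a _ _ hy ⟨rfl, hvv⟩
    · obtain ⟨u', hu', hud'⟩ := T.isTree.connected.exists_adj_dist_add_one (Ne.symm hyv)
      have u1' := SimpleGraph.dist_eq_one_iff_adj.2 hu'
      have c6 := cm u' y
      have c7 := cm u' v
      have c8 := cm y (a • v)
      have c9 := cm y v
      have : u = u' := by
        refine T.isTree.eq_of_dist_add_one (w := v) hu hu' hu1 ?_
        have := tri u' y v; have := tri (a • v) u' v; omega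
      subst this
      omega)
  exact ⟨_, f, hf⟩

end MetricGTree

/-! ### Translation lengths and common fundamental domains -/

namespace MetricGTree

variable {G : Type u} [Group G] {T : MetricGTree G}

/-- The powers of an element acting on a line as a translation. -/
theorem zpow_smul_of_translation {X : Type*} [MulAction G X] {f : ℤ → X} {a : G} {c : ℤ}
    (h : ∀ i, a • f i = f (i + c)) (n i : ℤ) : a ^ n • f i = f (i + n * c) := by
  induction n using Int.induction_on generalizing i with
  | zero => simp
  | succ n ih => rw [zpow_add, mul_smul, zpow_one, h, ih]; congr 1; ring
  | pred n ih =>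
    have : a⁻¹ • f i = f (i - c) := by rw [inv_smul_eq_iff, h]; congr 1; ring
    rw [zpow_sub, mul_smul, zpow_one, this, ih]; congr 1; ring

namespace IsAxis

variable {a : G} {L : ℕ} {f : ℤ → T.V}

theorem zpow_smul (hf : T.IsAxis a L f) (n i : ℤ) : a ^ n • f i = f (i + n * L) :=
  zpow_smul_of_translation hf.smul_eq n i

theorem pow_smul (hf : T.IsAxis a L f) (n : ℕ) (i : ℤ) : a ^ n • f i = f (i + n * L) := by
  simpa using hf.zpow_smul n i

theorem injective (hf : T.IsAxis a L f) : Function.Injective f := by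
  intro i j h
  have := hf.dist_eq i j
  rw [h, SimpleGraph.dist_self] at this
  have := abs_eq_zero.1 this.symm
  omega

theorem exists_eq_of_between (hf : T.IsAxis a L f) {m : T.V} {i j : ℤ}
    (h : T.graph.dist (f i) m + T.graph.dist m (f j) = T.graph.dist (f i) (f j)) :
    ∃ k, m = f k := by
  have hij := hf.dist_eq i j
  rcases le_total i j with hle | hle
  · rw [abs_of_nonpos (by omega)] at hij
    refine ⟨i + T.graph.dist (f i) m, ?_⟩
    have e1 := hf.dist_eq i (i + T.graph.dist (f i) m)
    have e2 := hf.dist_eq (i + T.graph.dist (f i) m) j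
    rw [abs_of_nonpos (by omega)] at e1 e2
    exact T.isTree.eq_of_dist_eq h (by omega) (by omega)
  · rw [abs_of_nonneg (by omega)] at hij
    refine ⟨i - T.graph.dist (f i) m, ?_⟩
    have e1 := hf.dist_eq i (i - T.graph.dist (f i) m)
    have e2 := hf.dist_eq (i - T.graph.dist (f i) m) j
    rw [abs_of_nonneg (by omega)] at e1 e2
    exact T.isTree.eq_of_dist_eq h (by omega) (by omega)

/-- `f i` is a nearest point of the line: the median of `p`, `f i`, `f j` is on the line, so it
cannot be nearer to `p`. -/
theorem exists_projection (hf : T.IsAxis a L f) (p : T.V) :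
    ∃ i, ∀ j, (T.graph.dist p (f j) : ℤ) = T.graph.dist p (f i) + |i - j| := by
  obtain ⟨i, hi⟩ : ∃ i, ∀ j, T.graph.dist p (f i) ≤ T.graph.dist p (f j) :=
    ⟨_, fun j => Function.argmin_le (fun i => T.graph.dist p (f i)) j⟩
  refine ⟨i, fun j => ?_⟩
  obtain ⟨m, h1, h2, h3⟩ := T.isTree.exists_median p (f i) (f j)
  have hij := hf.dist_eq i j
  obtain ⟨k, hk⟩ := hf.exists_eq_of_between h2
  have := hi k
  rw [← hk] at this
  have hm : m = f i := (T.isTree.connected.dist_eq_zero_iff).1 (by omega)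
  rw [hm] at h3
  rw [← hij]
  omega

variable {i : ℤ} {p : T.V}

/-- The geodesic from `p` to `a ^ n • p` goes to the axis, follows it, and leaves it at the
translate of the projection. -/
theorem graphDist_zpow_smul (hf : T.IsAxis a L f)
    (hi : ∀ j, (T.graph.dist p (f j) : ℤ) = T.graph.dist p (f i) + |i - j|) {n : ℤ} (hn : n ≠ 0) :
    T.graph.dist p (a ^ n • f i) + T.graph.dist (a ^ n • f i) (a ^ n • p) =
      T.graph.dist p (a ^ n • p) ∧
    T.graph.dist p (f i) + T.graph.dist (f i) (a ^ n • p) = T.graph.dist p (a ^ n • p) ∧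
    (T.graph.dist p (a ^ n • p) : ℤ) = 2 * T.graph.dist p (f i) + |n| * L := by
  have hL : (0 : ℤ) < L := by exact_mod_cast hf.pos
  have h0 : T.graph.dist p (f i) + T.graph.dist (f i) (a ^ n • f i) =
      T.graph.dist p (a ^ n • f i) := by
    rw [hf.zpow_smul]
    zify
    rw [hi (_ + _), hf.dist_eq]
  have h1 : T.graph.dist (f i) (a ^ n • f i) + T.graph.dist (a ^ n • f i) (a ^ n • p) =
      T.graph.dist (f i) (a ^ n • p) := by
    have e : T.graph.dist (f i) (a ^ n • p) = T.graph.dist p (a ^ (-n) • f i) := by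
      rw [← T.graphDist_smul (a ^ (-n)), ← mul_smul, ← zpow_add, neg_add_cancel, zpow_zero,
        one_smul, SimpleGraph.dist_comm]
    rw [e, graphDist_smul, SimpleGraph.dist_comm (u := f i) (v := p), hf.zpow_smul, hf.zpow_smul]
    zify
    rw [hi (_ + _), hf.dist_eq, add_comm]
    congr 1
    rw [show i - (i + n * L) = -(i - (i + -n * L)) by ring, abs_neg]
  have h2 : (T.graph.dist (f i) (a ^ n • f i) : ℤ) = |n| * L := by
    rw [hf.zpow_smul, hf.dist_eq, show i - (i + n * L) = -(n * L) by ring, abs_neg, abs_mul,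
      Nat.abs_cast]
  have h3 := T.isTree.dist_eq_of_overlap h0 h1 (by
    intro h
    rw [← h, SimpleGraph.dist_self] at h2
    have := mul_pos (abs_pos.2 hn) hL
    omega)
  have h4 := T.graphDist_smul (a ^ n) (f i) p
  have h5 := SimpleGraph.dist_comm (G := T.graph) (u := f i) (v := p)
  exact ⟨h3, by omega, by omega⟩

theorem dist_add (hf : T.IsAxis a L f) {i j k : ℤ} (hij : i ≤ j) (hjk : j ≤ k) :
    T.dist (f i) (f j) + T.dist (f j) (f k) = T.dist (f i) (f k) := by
  refine T.dist_add ?_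
  zify
  rw [hf.dist_eq, hf.dist_eq, hf.dist_eq, abs_of_nonpos, abs_of_nonpos, abs_of_nonpos] <;> omega

theorem dist_smul_eq (hf : T.IsAxis a L f) (i : ℤ) :
    T.dist (f i) (a • f i) = T.dist (f 0) (a • f 0) := by
  have key : ∀ i, T.dist (f (i + 1)) (a • f (i + 1)) = T.dist (f i) (a • f i) := by
    intro i
    -- Cut the segment from `f i` to `f (i + 1 + L)` in two ways: the leftover edges are translates
    -- of each other and have equal length.
    have h1 := hf.dist_add (i := i) (j := i + 1) (k := i + 1 + L) (by omega) (by omega)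
    have h2 := hf.dist_add (i := i) (j := i + L) (k := i + 1 + L) (by omega) (by omega)
    rw [← hf.smul_eq (i + 1)] at h1 h2
    rw [← hf.smul_eq i, T.dist_smul] at h2
    linarith
  induction i using Int.induction_on with
  | zero => rfl
  | succ n ih => rw [key, ih]
  | pred n ih => rw [← ih, ← key]; simp

theorem dist_smul_of_projection (hf : T.IsAxis a L f)
    (hi : ∀ j, (T.graph.dist p (f j) : ℤ) = T.graph.dist p (f i) + |i - j|) :
    T.dist p (a • p) = 2 * T.dist p (f i) + T.dist (f 0) (a • f 0) := by
  obtain ⟨h1, h2, h3⟩ := hf.graphDist_zpow_smul hi (n := 1) one_ne_zero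
  rw [zpow_one] at h1 h2 h3
  have h5 : T.graph.dist p (f i) + T.graph.dist (f i) (a • f i) = T.graph.dist p (a • f i) := by
    rw [hf.smul_eq]
    zify
    rw [hi (_ + _), hf.dist_eq]
  have e1 := T.dist_add h1
  have e2 := T.dist_add h5
  rw [T.dist_smul, T.dist_comm (f i) p] at e1
  rw [← hf.dist_smul_eq i]
  linarith

theorem translationLength_eq (hf : T.IsAxis a L f) :
    T.translationLength a = T.dist (f 0) (a • f 0) := by
  have : Nonempty T.V := ⟨f 0⟩
  refine le_antisymm (ciInf_le ⟨0, ?_⟩ (f 0)) (le_ciInf fun p => ?_)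
  · rintro _ ⟨v, rfl⟩
    exact T.dist_nonneg _ _
  · obtain ⟨i, hi⟩ := hf.exists_projection p
    rw [hf.dist_smul_of_projection hi]
    have := T.dist_nonneg p (f i)
    linarith

theorem axis_eq (hf : T.IsAxis a L f) : T.axis a = Set.range f := by
  ext p
  simp only [axis, Set.mem_ofPred_eq, Set.mem_range]
  rw [hf.translationLength_eq]
  constructor
  · intro h
    obtain ⟨i, hi⟩ := hf.exists_projection p
    rw [hf.dist_smul_of_projection hi] at h
    refine ⟨i, ?_⟩
    by_contra hne
    have := T.dist_pos (Ne.symm hne)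
    linarith
  · rintro ⟨i, rfl⟩
    exact hf.dist_smul_eq i

theorem dist_pow_smul (hf : T.IsAxis a L f) (i : ℤ) (n : ℕ) :
    T.dist (f i) (a ^ n • f i) = n * T.translationLength a := by
  induction n with
  | zero => simp
  | succ n ih =>
    have hnL : (0 : ℤ) ≤ n * L := by positivity
    have h := hf.dist_add (i := i) (j := i + n * L) (k := i + n * L + L) (by omega) (by omega)
    rw [← hf.smul_eq, hf.dist_smul_eq, ← hf.translationLength_eq, ← hf.pow_smul, ih, ← mul_smul,
      ← pow_succ'] at h
    rw [← h]
    push_cast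
    ring

theorem graphDist_pow_smul (hf : T.IsAxis a L f) (i : ℤ) (n : ℕ) :
    T.graph.dist (f i) (a ^ n • f i) = n * L := by
  have hnL : (0 : ℤ) ≤ n * L := by positivity
  zify
  rw [hf.pow_smul, hf.dist_eq, abs_of_nonpos (by omega)]
  ring

end IsAxis

/-- At distance `d` from the axis, `a` and its square displace by `2 * d + L` and `2 * d + 2 * L`;
the hypothesis forces `d = 0`. -/
theorem mem_axis_of_graphDist {a : G} (ha : T.IsLoxodromic a) {w : T.V}
    (h : T.graph.dist w (a • a • w) = 2 * T.graph.dist w (a • w)) : w ∈ T.axis a := by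
  obtain ⟨L, f, hf⟩ := ha.exists_isAxis
  obtain ⟨i, hi⟩ := hf.exists_projection w
  have h1 := (hf.graphDist_zpow_smul hi (n := 1) (by norm_num)).2.2
  have h2 := (hf.graphDist_zpow_smul hi (n := 2) (by norm_num)).2.2
  rw [zpow_one] at h1
  rw [show (2 : ℤ) = 1 + 1 by norm_num, zpow_add, zpow_one, mul_smul] at h2
  norm_num at h1 h2
  rw [hf.axis_eq]
  exact ⟨i, ((T.isTree.connected.dist_eq_zero_iff).1 (by omega)).symm⟩

theorem dist_pow_smul_of_mem_axis {a : G} (ha : T.IsLoxodromic a) {v : T.V} (hv : v ∈ T.axis a)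
    (n : ℕ) : T.dist v (a ^ n • v) = n * T.translationLength a := by
  obtain ⟨L, f, hf⟩ := ha.exists_isAxis
  rw [hf.axis_eq] at hv
  obtain ⟨i, rfl⟩ := hv
  exact hf.dist_pow_smul i n

theorem dist_conj_smul (T : MetricGTree G) (h a : G) (v : T.V) :
    T.dist (h • v) ((h * a * h⁻¹) • h • v) = T.dist v (a • v) := by
  rw [← mul_smul, inv_mul_cancel_right, mul_smul, T.dist_smul]

theorem translationLength_conj (T : MetricGTree G) (h a : G) :
    T.translationLength (h * a * h⁻¹) = T.translationLength a :=
  ((MulAction.toPerm h).surjective.iInf_congr _ fun v => T.dist_conj_smul h a v).symm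

theorem conj_mem_axis_iff {a h : G} {v : T.V} :
    h • v ∈ T.axis (h * a * h⁻¹) ↔ v ∈ T.axis a := by
  simp only [axis, Set.mem_ofPred_eq, dist_conj_smul, translationLength_conj]

theorem isLoxodromic_conj {a : G} (ha : T.IsLoxodromic a) (h : G) :
    T.IsLoxodromic (h * a * h⁻¹) := by
  intro v hv
  refine ha (h⁻¹ • v) ?_
  rwa [eq_inv_smul_iff, ← mul_smul, ← mul_smul]

theorem shareFundamentalDomains_iff {N : ℕ} {a b : G} :
    T.ShareFundamentalDomains N a b ↔ ∃ h : G, ∃ v : T.V, v ∈ T.axis a ∧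
      v ∈ T.axis (h * b * h⁻¹) ∧ a ^ N • v = (h * b * h⁻¹) ^ N • v := by
  simp only [ShareFundamentalDomains, segment_eq_iff]

theorem ShareFundamentalDomains.symm {N : ℕ} {a b : G} (h : T.ShareFundamentalDomains N a b) :
    T.ShareFundamentalDomains N b a := by
  rw [shareFundamentalDomains_iff] at *
  obtain ⟨h, v, h1, h2, h3⟩ := h
  refine ⟨h⁻¹, h⁻¹ • v, ?_, conj_mem_axis_iff.2 h1, ?_⟩
  · rw [← conj_mem_axis_iff (h := h)]
    simpa using h2
  · rw [conj_pow, mul_smul, mul_smul, inv_inv, smul_inv_smul, h3, conj_pow, mul_smul,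
      mul_smul, inv_smul_smul]

/-- If two loxodromic elements share `N` fundamental domains starting from a common point of their
axes, then they agree on the successive translates of this point. -/
theorem pow_smul_eq_of_le {N : ℕ} (hN : 1 ≤ N) {a c : G} (ha : T.IsLoxodromic a)
    (hc : T.IsLoxodromic c) {v : T.V} (hva : v ∈ T.axis a) (hvc : v ∈ T.axis c)
    (h : a ^ N • v = c ^ N • v) {i : ℕ} (hi : i ≤ N) : a ^ i • v = c ^ i • v := by
  obtain ⟨L, f, hf⟩ := ha.exists_isAxis
  obtain ⟨L', f', hf'⟩ := hc.exists_isAxis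
  rw [hf.axis_eq] at hva
  rw [hf'.axis_eq] at hvc
  obtain ⟨k, rfl⟩ := hva
  obtain ⟨k', hk⟩ := hvc
  have d1 : ∀ n, T.graph.dist (f k) (a ^ n • f k) = n * L := hf.graphDist_pow_smul k
  have d2 : ∀ n, T.graph.dist (f k) (c ^ n • f k) = n * L' := by
    rw [← hk]; exact hf'.graphDist_pow_smul k'
  have e : L = L' := by
    have := d1 N
    rw [h, d2 N] at this
    exact (Nat.eq_of_mul_eq_mul_left hN this).symm
  subst e
  obtain ⟨j, rfl⟩ := Nat.exists_eq_add_of_le hi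
  refine T.isTree.eq_of_dist_eq (x := f k) (z := a ^ (i + j) • f k) ?_ ?_ (by rw [d1, d2])
  · rw [pow_add, mul_smul, graphDist_smul, ← mul_smul, ← pow_add, d1, d1, d1]; ring
  · rw [h, pow_add c, mul_smul, graphDist_smul, ← mul_smul, ← pow_add, d2, d2, d2]; ring

theorem ShareFundamentalDomains.translationLength_eq {N : ℕ} (hN : 1 ≤ N) {a b : G}
    (ha : T.IsLoxodromic a) (hb : T.IsLoxodromic b) (h : T.ShareFundamentalDomains N a b) :
    T.translationLength a = T.translationLength b := by
  obtain ⟨h, v, h1, h2, h3⟩ := shareFundamentalDomains_iff.1 h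
  have e1 := dist_pow_smul_of_mem_axis ha h1 N
  have e2 := dist_pow_smul_of_mem_axis (isLoxodromic_conj hb h) h2 N
  rw [← h3, e1, translationLength_conj] at e2
  have : (N : ℝ) ≠ 0 := by positivity
  exact mul_left_cancel₀ this e2

theorem ShareFundamentalDomains.mono {M N : ℕ} (hMN : M ≤ N) (hN : 1 ≤ N) {a b : G}
    (ha : T.IsLoxodromic a) (hb : T.IsLoxodromic b) (h : T.ShareFundamentalDomains N a b) :
    T.ShareFundamentalDomains M a b := by
  obtain ⟨h, v, h1, h2, h3⟩ := shareFundamentalDomains_iff.1 h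
  exact shareFundamentalDomains_iff.2
    ⟨h, v, h1, h2, pow_smul_eq_of_le hN ha (isLoxodromic_conj hb h) h1 h2 h3 hMN⟩

/-- Sharing at least two fundamental domains only depends on the elliptic subgroups. -/
theorem ShareFundamentalDomains.of_isElliptic {S : MetricGTree G}
    (hTS : ∀ H, T.IsElliptic H → S.IsElliptic H) {a b : G}
    (haT : T.IsLoxodromic a) (hbT : T.IsLoxodromic b) (haS : S.IsLoxodromic a)
    (hbS : S.IsLoxodromic b) {N : ℕ} (hN : 2 ≤ N) (h : T.ShareFundamentalDomains N a b) :
    S.ShareFundamentalDomains N a b := by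
  obtain ⟨h, v, h1, h2, h3⟩ := shareFundamentalDomains_iff.1 h
  have hcS := isLoxodromic_conj hbS h
  have hcT := isLoxodromic_conj hbT h
  rw [shareFundamentalDomains_iff]
  refine ⟨h, ?_⟩
  generalize h * b * h⁻¹ = c at *
  have hpow : ∀ i ≤ N, a ^ i • v = c ^ i • v := fun i hi =>
    pow_smul_eq_of_le (by omega) haT hcT h1 h2 h3 hi
  have hu : ∀ i < N, (a⁻¹ * c) • a ^ i • v = a ^ i • v := by
    intro i hi
    rw [hpow i hi.le, mul_smul, ← mul_smul c, ← pow_succ', ← hpow (i + 1) hi, inv_smul_eq_iff,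
      pow_succ', mul_smul, ← hpow i hi.le]
  -- One point `p` serves for all the conjugates of `a⁻¹ * c` by `a ^ (-i)`, since they all lie in
  -- the stabilizer of `v`.
  obtain ⟨p, hp⟩ := hTS (MulAction.stabilizer G v) ⟨v, fun g hg => hg⟩
  have hup : ∀ i < N, (a⁻¹ * c) • a ^ i • p = a ^ i • p := by
    intro i hi
    have := hp ((a ^ i)⁻¹ * (a⁻¹ * c) * a ^ i) (by
      rw [MulAction.mem_stabilizer_iff, mul_smul, mul_smul, hu i hi, inv_smul_smul])
    rwa [mul_smul, mul_smul, inv_smul_eq_iff] at this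
  obtain ⟨L, f, hf⟩ := haS.exists_isAxis
  obtain ⟨i, hi⟩ := hf.exists_projection p
  -- Here `2 ≤ N` is needed: the exponent `N - 1` must be nonzero for the geodesic from `p` to its
  -- translate to meet the axis.
  obtain ⟨b1, b2, -⟩ := hf.graphDist_zpow_smul hi (n := ((N - 1 : ℕ) : ℤ)) (by omega)
  rw [zpow_natCast] at b1 b2
  have p0 : (a⁻¹ * c) • p = p := by simpa using hup 0 (by omega)
  have p1 := hup (N - 1) (by omega)
  have w0 := S.smul_eq_of_between p0 p1 b2
  have w1 := S.smul_eq_of_between p0 p1 b1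
  have hw : ∀ j < N, (a⁻¹ * c) • a ^ j • f i = a ^ j • f i := by
    intro j hj
    refine S.smul_eq_of_between w0 w1 ?_
    obtain ⟨k, hk⟩ := Nat.exists_eq_add_of_le (show j ≤ N - 1 by omega)
    rw [hk, pow_add, mul_smul, graphDist_smul, ← mul_smul, ← pow_add, hf.graphDist_pow_smul,
      hf.graphDist_pow_smul, hf.graphDist_pow_smul]
    ring
  have hcw : ∀ j ≤ N, a ^ j • f i = c ^ j • f i := by
    intro j hj
    induction j with
    | zero => simp
    | succ j ih =>
      rw [pow_succ' c, mul_smul, ← ih (by omega)]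
      have := hw j (by omega)
      rw [mul_smul, inv_smul_eq_iff] at this
      rw [this, pow_succ', mul_smul]
  have c1 := hcw 1 (by omega)
  have c2 := hcw 2 (by omega)
  refine ⟨f i, by rw [hf.axis_eq]; exact ⟨i, rfl⟩, mem_axis_of_graphDist hcS ?_, hcw N le_rfl⟩
  have d1 := hf.graphDist_pow_smul i 1
  have d2 := hf.graphDist_pow_smul i 2
  rw [c1] at d1
  rw [c2] at d2
  rw [pow_one] at d1
  rw [pow_two, mul_smul] at d2
  omega

end MetricGTree

/-! ### Commensurable stabilizers -/

namespace MetricGTree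

variable {G : Type u} [Group G] {T : MetricGTree G}

/-- A minimal tree with infinite cyclic vertex stabilizers, all of which contain a nontrivial power
of the element `e`, of infinite order. -/
structure IsCommensuratedBy (T : MetricGTree G) (e : G) : Prop where
  minimal : T.IsMinimal
  isCyclic : ∀ v : T.V, IsCyclic (MulAction.stabilizer G v)
  infinite : ¬ IsOfFinOrder e
  exists_zpow_smul : ∀ v : T.V, ∃ k : ℤ, k ≠ 0 ∧ e ^ k • v = v

theorem exists_stabilizer_generator (hc : ∀ v : T.V, IsCyclic (MulAction.stabilizer G v))
    (v : T.V) : ∃ t : G, t • v = v ∧ ∀ g : G, g • v = v → ∃ n : ℤ, t ^ n = g := by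
  obtain ⟨⟨t, ht⟩, h⟩ := (hc v).exists_generator
  refine ⟨t, ht, fun g hg => ?_⟩
  obtain ⟨n, hn⟩ := h ⟨g, hg⟩
  exact ⟨n, congrArg Subtype.val hn⟩

/-- `e` generates one vertex stabilizer. Crossing an edge keeps some nonzero power of `e` in the
stabilizer, because the edge group is a nontrivial subgroup of a cyclic vertex group. -/
theorem IsGBSTree.exists_isCommensuratedBy (h : T.IsGBSTree) :
    ∃ e, T.IsCommensuratedBy e ∧ ∃ v : T.V, e • v = v := by
  obtain ⟨v₀⟩ := T.isTree.connected.nonempty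
  have hc : ∀ v : T.V, IsCyclic (MulAction.stabilizer G v) := fun v => (h.2.1 v).1
  obtain ⟨e, he, hgen⟩ := exists_stabilizer_generator hc v₀
  refine ⟨e, ⟨h.1, hc, ?_, fun w => ?_⟩, v₀, he⟩
  · rw [← infinite_zpowers]
    have : Subgroup.zpowers e = MulAction.stabilizer G v₀ := by
      ext g
      rw [Subgroup.mem_zpowers_iff, MulAction.mem_stabilizer_iff]
      refine ⟨?_, hgen g⟩
      rintro ⟨n, rfl⟩
      exact (MulAction.stabilizer G v₀).zpow_mem he n
    rw [this, ← Set.infinite_coe_iff]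
    exact (h.2.1 v₀).2
  · obtain ⟨p⟩ := T.isTree.connected.preconnected w v₀
    induction p with
    | nil => exact ⟨1, one_ne_zero, by simpa using he⟩
    | @cons w v _ hvw p ih =>
      obtain ⟨k, hk, hkv⟩ := ih he hgen
      obtain ⟨t, ht, htgen⟩ := exists_stabilizer_generator hc v
      have := (h.2.2 w v hvw).2
      obtain ⟨⟨x, hxw, hxv⟩, hx⟩ := exists_ne
        (1 : (MulAction.stabilizer G w ⊓ MulAction.stabilizer G v : Subgroup G))
      obtain ⟨m, hm⟩ := htgen _ hkv
      obtain ⟨n, hn⟩ := htgen x hxv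
      have hn0 : n ≠ 0 := by
        rintro rfl
        apply hx
        ext
        simpa using hn.symm
      refine ⟨k * n, mul_ne_zero hk hn0, ?_⟩
      rw [zpow_mul, ← hm, ← zpow_mul, mul_comm, zpow_mul, hn]
      exact (MulAction.stabilizer G w).zpow_mem hxw m

namespace IsCommensuratedBy

variable {e : G}

theorem zpow_ne_one (h : T.IsCommensuratedBy e) {k : ℤ} (hk : k ≠ 0) : e ^ k ≠ 1 := by
  intro h1
  exact h.infinite (isOfFinOrder_iff_zpow_eq_one.2 ⟨k, hk, h1⟩)

theorem eq_zero_of_zpow_eq_one (h : T.IsCommensuratedBy e) {v : T.V} {t : G}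
    (ht : ∀ g : G, g • v = v → ∃ n : ℤ, t ^ n = g) (n : ℤ) (hn : t ^ n = 1) : n = 0 := by
  by_contra hn0
  obtain ⟨k, hk, hkv⟩ := h.exists_zpow_smul v
  obtain ⟨m, hm⟩ := ht _ hkv
  refine h.zpow_ne_one (mul_ne_zero hk hn0) ?_
  rw [zpow_mul, ← hm, ← zpow_mul, mul_comm, zpow_mul, hn, one_zpow]

theorem exists_zpow_eq (h : T.IsCommensuratedBy e) {x : G} (hx : x ≠ 1) {v : T.V}
    (hv : x • v = v) : ∃ k l : ℤ, k ≠ 0 ∧ l ≠ 0 ∧ x ^ k = e ^ l := by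
  obtain ⟨t, ht, htgen⟩ := exists_stabilizer_generator h.isCyclic v
  obtain ⟨j, hj, hjv⟩ := h.exists_zpow_smul v
  obtain ⟨m, hm⟩ := htgen x hv
  obtain ⟨n, hn⟩ := htgen _ hjv
  refine ⟨n, j * m, ?_, mul_ne_zero hj ?_, ?_⟩
  · rintro rfl
    exact h.zpow_ne_one hj (by simpa using hn.symm)
  · rintro rfl
    exact hx (by simpa using hm.symm)
  · rw [zpow_mul, ← hn, ← hm, ← zpow_mul, ← zpow_mul, mul_comm]

/-- Elliptic elements are commensurable with their conjugates. -/
theorem exists_conj_zpow_eq (h : T.IsCommensuratedBy e) {x : G} {v : T.V}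
    (hv : x • v = v) (g : G) : ∃ k l : ℤ, k ≠ 0 ∧ l ≠ 0 ∧ g * x ^ k * g⁻¹ = x ^ l := by
  by_cases hx : x = 1
  · exact ⟨1, 1, by simp [hx]⟩
  obtain ⟨k, l, hk, hl, hkl⟩ := h.exists_zpow_eq hx hv
  obtain ⟨k', l', hk', hl', hkl'⟩ := h.exists_zpow_eq (x := g * x * g⁻¹) (v := g • v)
    (by simpa using hx) (by rw [← mul_smul, inv_mul_cancel_right, mul_smul, hv])
  rw [conj_zpow] at hkl'
  refine ⟨k' * l, k * l', mul_ne_zero hk' hl, mul_ne_zero hk hl', ?_⟩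
  rw [zpow_mul, ← conj_zpow, hkl', zpow_mul x, hkl, ← zpow_mul, ← zpow_mul, mul_comm]

end IsCommensuratedBy

theorem connected_induce {W : Set T.V} (hne : W.Nonempty)
    (h : ∀ v ∈ W, ∀ w ∈ W, ∃ p : T.graph.Walk v w, ∀ x ∈ p.support, x ∈ W) :
    (T.graph.induce W).Connected := by
  have : Nonempty W := hne.to_subtype
  refine ⟨fun ⟨v, hv⟩ ⟨w, hw⟩ => ?_⟩
  obtain ⟨p, hp⟩ := h v hv w hw
  exact ⟨p.induce W hp⟩

theorem IsMinimal.eq_univ {W : Set T.V} (hT : T.IsMinimal) (hne : W.Nonempty)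
    (hinv : ∀ (g : G), ∀ v ∈ W, g • v ∈ W)
    (h : ∀ v ∈ W, ∀ w ∈ W, ∃ p : T.graph.Walk v w, ∀ x ∈ p.support, x ∈ W) (v : T.V) : v ∈ W :=
  hT W hne hinv (connected_induce hne h) ▸ Set.mem_univ v

/-- Stabilizers in `T` embed in stabilizers of `T₀`, so they are cyclic. The vertices fixed by some
nonzero power of `e` span a nonempty subtree, invariant because `e` is commensurable with its
conjugates; minimality makes it all of `T`. -/
theorem IsCommensuratedBy.of_mem_deformationSpace {T₀ : MetricGTree G} {e : G}
    (h : T₀.IsCommensuratedBy e) (he : ∃ v : T₀.V, e • v = v) (hT : T ∈ T₀.deformationSpace) :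
    T.IsCommensuratedBy e := by
  obtain ⟨v₀, hv₀⟩ := he
  refine ⟨hT.1, fun v => ?_, h.infinite, fun v => ?_⟩
  · obtain ⟨w, hw⟩ := (hT.2 (MulAction.stabilizer G v)).1 ⟨v, fun g hg => hg⟩
    have := h.isCyclic w
    exact isCyclic_of_injective (Subgroup.inclusion (K := MulAction.stabilizer G w) hw)
      (Subgroup.inclusion_injective _)
  · refine IsMinimal.eq_univ (W := {v | ∃ k : ℤ, k ≠ 0 ∧ e ^ k • v = v}) hT.1 ?_ ?_ ?_ v
    · obtain ⟨w, hw⟩ := (hT.2 (Subgroup.zpowers e)).2 ⟨v₀, fun g hg => by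
        obtain ⟨n, rfl⟩ := Subgroup.mem_zpowers_iff.1 hg
        exact (MulAction.stabilizer G v₀).zpow_mem hv₀ n⟩
      exact ⟨w, 1, one_ne_zero, hw _ (by simp)⟩
    · rintro g v ⟨k, hk, hkv⟩
      obtain ⟨p, q, hp, hq, hpq⟩ := h.exists_conj_zpow_eq hv₀ g
      refine ⟨q * k, mul_ne_zero hq hk, ?_⟩
      rw [zpow_mul, ← hpq, conj_zpow, ← mul_smul, inv_mul_cancel_right, mul_smul, ← zpow_mul,
        mul_comm, zpow_mul]
      congr 1
      exact (MulAction.stabilizer G v).zpow_mem hkv p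
    · rintro v ⟨k, hk, hkv⟩ w ⟨l, hl, hlw⟩
      refine ⟨T.geodesic v w, fun x hx => ⟨k * l, mul_ne_zero hk hl, ?_⟩⟩
      refine T.smul_eq_of_between (x := v) (z := w) ?_ ?_ (T.dist_add_of_mem_segment hx)
      · rw [zpow_mul]; exact (MulAction.stabilizer G v).zpow_mem hkv l
      · rw [mul_comm, zpow_mul]; exact (MulAction.stabilizer G w).zpow_mem hlw k

/-! ### Cocompactness, local finiteness and the pigeonhole argument -/

/-- A minimal action of a finitely generated group has finitely many orbits of edges. -/
theorem IsMinimal.exists_finite_edges [Group.FG G] (hT : T.IsMinimal) :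
    ∃ P : Set (T.V × T.V), P.Finite ∧
      ∀ x y, T.graph.Adj x y → ∃ g : G, (g • x, g • y) ∈ P := by
  obtain ⟨S, hS⟩ := Group.fg_def.1 (inferInstance : Group.FG G)
  obtain ⟨w⟩ := T.isTree.connected.nonempty
  let P : Set (T.V × T.V) := ⋃ s ∈ S, {q | q ∈ (T.geodesic w (s • w)).darts.map fun d => d.toProd}
  have hP : P.Finite := S.finite_toSet.biUnion fun s _ => List.finite_toSet _
  -- `H` consists of the translates of the paths from `w` to `s • w`, for generators `s`. It is
  -- connected and spanning, so it is the whole tree.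
  let H : SimpleGraph T.V :=
    { Adj := fun x y => T.graph.Adj x y ∧ ∃ g : G, (g • x, g • y) ∈ P ∨ (g • y, g • x) ∈ P
      symm := ⟨fun x y ⟨h, g, hg⟩ => ⟨h.symm, g, hg.symm⟩⟩
      loopless := ⟨fun x h => T.graph.loopless.irrefl x h.1⟩ }
  have hHT : H ≤ T.graph := fun x y h => h.1
  have hsmul : ∀ (g : G) x y, H.Reachable x y → H.Reachable (g • x) (g • y) := by
    rintro g x y ⟨p⟩
    let F : H →g H := ⟨fun v => g • v, fun {a b} hab => ⟨T.adj_smul g _ _ hab.1, by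
      obtain ⟨k, hk⟩ := hab.2
      exact ⟨k * g⁻¹, by simpa only [← mul_smul, inv_mul_cancel_right] using hk⟩⟩⟩
    exact ⟨p.map F⟩
  have hreach : ∀ g : G, H.Reachable w (g • w) := by
    intro g
    have hg : g ∈ Subgroup.closure (S : Set G) := hS ▸ Subgroup.mem_top g
    induction hg using Subgroup.closure_induction with
    | mem s hs =>
      refine ⟨(T.geodesic w (s • w)).transfer H fun q hq => ?_⟩
      obtain ⟨d, hd, rfl⟩ := List.mem_map.1 hq
      exact ⟨d.adj, 1, Or.inl (by
        simp only [one_smul]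
        exact Set.mem_biUnion (show s ∈ S from hs) (List.mem_map.2 ⟨d, hd, rfl⟩))⟩
    | one => simp
    | mul g h _ _ hg hh => rw [mul_smul]; exact hg.trans (hsmul g _ _ hh)
    | inv g _ hg => simpa using (hsmul g⁻¹ _ _ hg).symm
  have hall : ∀ v, H.Reachable w v := by
    refine IsMinimal.eq_univ (W := {v | H.Reachable w v}) hT ⟨w, SimpleGraph.Reachable.refl _⟩
      (fun g v hv => (hreach g).trans (hsmul g _ _ hv)) fun v hv v' hv' => ?_
    obtain ⟨p⟩ := (SimpleGraph.Reachable.symm hv).trans hv'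
    classical
    refine ⟨p.mapLe hHT, fun x hx => ?_⟩
    rw [SimpleGraph.Walk.support_mapLe_eq_support] at hx
    exact SimpleGraph.Reachable.trans hv ⟨p.takeUntil x hx⟩
  have hconn : H.Connected := by
    have : Nonempty T.V := ⟨w⟩
    exact ⟨fun x y => (hall x).symm.trans (hall y)⟩
  have hle : T.graph ≤ H :=
    (SimpleGraph.isTree_iff_minimal_connected.1 T.isTree).2 hconn hHT
  refine ⟨P ∪ Prod.swap '' P, hP.union (hP.image _), fun x y hxy => ?_⟩
  obtain ⟨g, hg | hg⟩ := (hle hxy).2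
  · exact ⟨g, Or.inl hg⟩
  · exact ⟨g, Or.inr ⟨_, hg, rfl⟩⟩

theorem IsMinimal.exists_pos_le_len [Group.FG G] (hT : T.IsMinimal) :
    ∃ ε : ℝ, 0 < ε ∧ ∀ v w, T.graph.Adj v w → ε ≤ T.len v w := by
  obtain ⟨P, hP, h⟩ := hT.exists_finite_edges
  obtain ⟨ε, hε, hle⟩ : ∃ ε : ℝ, 0 < ε ∧ ∀ q ∈ P, T.graph.Adj q.1 q.2 → ε ≤ T.len q.1 q.2 := by
    clear h
    induction P, hP using Set.Finite.induction_on with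
    | empty => exact ⟨1, one_pos, by simp⟩
    | @insert q P _ _ ih =>
      obtain ⟨ε, hε, h⟩ := ih
      by_cases hq : T.graph.Adj q.1 q.2
      · refine ⟨min ε (T.len q.1 q.2), lt_min hε (T.len_pos _ _ hq), ?_⟩
        rintro r (rfl | hr) ha
        · exact min_le_right _ _
        · exact (min_le_left _ _).trans (h r hr ha)
      · refine ⟨ε, hε, ?_⟩
        rintro r (rfl | hr) ha
        · exact absurd ha hq
        · exact h r hr ha
  refine ⟨ε, hε, fun v w hvw => ?_⟩
  obtain ⟨g, hg⟩ := h v w hvw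
  rw [← T.len_smul g v w hvw]
  exact hle _ hg (T.adj_smul g _ _ hvw)

/-- The neighbours of `v` in one edge orbit form a single orbit of the stabilizer of `v`, a cyclic
group some nonzero power of whose generator fixes such a neighbour. -/
theorem IsCommensuratedBy.finite_neighborSet [Group.FG G] {e : G} (h : T.IsCommensuratedBy e)
    (v : T.V) : (T.graph.neighborSet v).Finite := by
  obtain ⟨P, hP, hadj⟩ := h.minimal.exists_finite_edges
  have hsub : T.graph.neighborSet v ⊆ ⋃ r ∈ P, {y | ∃ g : G, g • v = r.1 ∧ g • y = r.2} := by
    intro y hy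
    obtain ⟨g, hg⟩ := hadj v y hy
    exact Set.mem_biUnion hg ⟨g, rfl, rfl⟩
  refine (hP.biUnion ?_).subset hsub
  rintro ⟨p, q⟩ -
  by_cases hne : ∃ g : G, g • v = p
  · obtain ⟨g₀, rfl⟩ := hne
    obtain ⟨t, ht, htgen⟩ := exists_stabilizer_generator h.isCyclic (g₀ • v)
    obtain ⟨k, hk, hkp⟩ := h.exists_zpow_smul (g₀ • v)
    obtain ⟨l, hl, hlq⟩ := h.exists_zpow_smul q
    obtain ⟨n, hn⟩ := htgen _ hkp
    have hn0 : n ≠ 0 := by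
      rintro rfl
      exact h.zpow_ne_one hk (by simpa using hn.symm)
    have hnq : ∀ j : ℤ, t ^ (n * l * j) • q = q := fun j => by
      have : t ^ (n * l * j) = ((e ^ l) ^ k) ^ j := by
        rw [mul_assoc, zpow_mul, hn, ← zpow_mul, ← zpow_mul, ← zpow_mul]
        congr 1
        ring
      rw [this]
      exact (MulAction.stabilizer G q).zpow_mem
        ((MulAction.stabilizer G q).zpow_mem hlq k) j
    have hnl := mul_ne_zero hn0 hl
    refine ((Set.finite_Ico (0 : ℤ) |n * l|).image fun i => (g₀⁻¹ * t ^ i) • q).subset ?_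
    rintro y ⟨g, hg, rfl⟩
    obtain ⟨i, hi⟩ := htgen (g₀ * g⁻¹) (by
      rw [mul_smul, show g₀ • v = g • v from hg.symm, inv_smul_smul]
      exact hg.symm)
    refine ⟨i % (n * l), ⟨Int.emod_nonneg _ hnl, Int.emod_lt_abs _ hnl⟩, ?_⟩
    have := Int.emod_add_mul_ediv i (n * l)
    rw [← this, zpow_add] at hi
    have e2 : t ^ (i % (n * l)) • g • y = (g₀ * g⁻¹) • g • y := by
      rw [← hi, mul_smul, hnq]
    simp only [mul_smul]
    rw [e2, mul_smul, inv_smul_smul, inv_smul_smul]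
  · refine Set.finite_empty.subset ?_
    rintro y ⟨g, hg, -⟩
    exact hne ⟨g, hg⟩

theorem IsCommensuratedBy.exists_finite_pairs [Group.FG G] {e : G} (h : T.IsCommensuratedBy e)
    (K : ℕ) : ∃ F : Set (T.V × T.V), F.Finite ∧
      ∀ v w, T.graph.dist v w ≤ K → ∃ g : G, (g • v, g • w) ∈ F := by
  induction K with
  | zero =>
    obtain ⟨P, hP, hadj⟩ := h.minimal.exists_finite_edges
    obtain ⟨u⟩ := T.isTree.connected.nonempty
    refine ⟨insert (u, u) ((fun q => (q.1, q.1)) '' P), (hP.image _).insert _, fun v w hd => ?_⟩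
    obtain rfl : v = w := (T.isTree.connected.dist_eq_zero_iff).1 (by omega)
    by_cases hvu : v = u
    · exact ⟨1, Or.inl (by simp [hvu])⟩
    · obtain ⟨y, hy, -⟩ := T.isTree.connected.exists_adj_dist_add_one hvu
      obtain ⟨g, hg⟩ := hadj v y hy
      exact ⟨g, Or.inr ⟨_, hg, rfl⟩⟩
  | succ K ih =>
    obtain ⟨F, hF, hFd⟩ := ih
    refine ⟨F ∪ ⋃ q ∈ F, (fun y => (q.1, y)) '' T.graph.neighborSet q.2,
      hF.union (hF.biUnion fun q _ => (h.finite_neighborSet q.2).image _), fun v w hd => ?_⟩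
    by_cases hvw : w = v
    · obtain ⟨g, hg⟩ := hFd v w (by simp [hvw])
      exact ⟨g, Or.inl hg⟩
    · obtain ⟨y, hy, hyd⟩ := T.isTree.connected.exists_adj_dist_add_one hvw
      obtain ⟨g, hg⟩ := hFd v y (by
        rw [SimpleGraph.dist_comm (u := v)] at *; omega)
      exact ⟨g, Or.inr (Set.mem_biUnion hg ⟨g • w, T.adj_smul g _ _ hy.symm, rfl⟩)⟩

/-- In a sequence of loxodromic elements with bounded translation length, some two elements share
`N` fundamental domains. -/
theorem IsCommensuratedBy.exists_shareFundamentalDomains [Group.FG G] {e : G}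
    (h : T.IsCommensuratedBy e) (a : ℕ → G) (ha : ∀ n, T.IsLoxodromic (a n)) {B : ℝ}
    (hB : ∀ n, T.translationLength (a n) ≤ B) (N : ℕ) :
    ∃ n m, n ≠ m ∧ T.ShareFundamentalDomains N (a n) (a m) := by
  obtain ⟨ε, hε, hlen⟩ := h.minimal.exists_pos_le_len
  have hax : ∀ n, ∃ v, v ∈ T.axis (a n) := fun n => by
    obtain ⟨L, f, hf⟩ := (ha n).exists_isAxis
    exact ⟨f 0, by rw [hf.axis_eq]; exact ⟨0, rfl⟩⟩
  choose v hv using hax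
  -- `N` domains have length at most `N * B`, and every edge has length at least `ε`.
  obtain ⟨F, hF, hFd⟩ := h.exists_finite_pairs ⌈N * B / ε⌉₊
  have hd : ∀ n, T.graph.dist (v n) (a n ^ N • v n) ≤ ⌈N * B / ε⌉₊ := fun n => by
    have h1 := T.mul_graphDist_le hlen (v n) (a n ^ N • v n)
    rw [dist_pow_smul_of_mem_axis (ha n) (hv n)] at h1
    have h2 : (T.graph.dist (v n) (a n ^ N • v n) : ℝ) ≤ N * B / ε := by
      rw [le_div_iff₀ hε, mul_comm]
      exact h1.trans (mul_le_mul_of_nonneg_left (hB n) (by positivity))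
    exact_mod_cast h2.trans (Nat.le_ceil _)
  choose g hg using fun n => hFd _ _ (hd n)
  have := hF.to_subtype
  obtain ⟨n, m, hnm, heq⟩ := Finite.exists_ne_map_eq_of_infinite
    (fun n => (⟨_, hg n⟩ : F))
  simp only [Subtype.mk.injEq, Prod.mk.injEq] at heq
  have hvn : v n = ((g n)⁻¹ * g m) • v m := by rw [mul_smul, ← heq.1, inv_smul_smul]
  refine ⟨n, m, hnm, shareFundamentalDomains_iff.2 ⟨(g n)⁻¹ * g m, v n, hv n, ?_, ?_⟩⟩
  · rw [hvn, conj_mem_axis_iff]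
    exact hv m
  · have hk : ((g n)⁻¹ * g m)⁻¹ • v n = v m := by rw [inv_smul_eq_iff, ← hvn]
    rw [conj_pow, mul_smul, mul_smul, hk, mul_smul, ← heq.2, inv_smul_smul]

end MetricGTree

/-! ### Recognizing `ℤ²` and the Klein bottle group from normal forms -/

section Elementary

variable {G : Type u} [Group G] {u t : G}

theorem nonempty_mulEquiv_int_prod_int (hut : t * u * t⁻¹ = u)
    (hsurj : ∀ g : G, ∃ i j : ℤ, u ^ i * t ^ j = g)
    (hinj : ∀ i j : ℤ, u ^ i * t ^ j = 1 → i = 0 ∧ j = 0) :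
    Nonempty (G ≃* Multiplicative (ℤ × ℤ)) := by
  have hc : Commute t u := by
    rw [mul_inv_eq_iff_eq_mul] at hut
    exact hut
  let F : Multiplicative (ℤ × ℤ) →* G :=
    { toFun := fun x => u ^ x.toAdd.1 * t ^ x.toAdd.2
      map_one' := by simp
      map_mul' := fun x y => by
        simp only [toAdd_mul, Prod.fst_add, Prod.snd_add, zpow_add]
        have := (hc.zpow_zpow x.toAdd.2 y.toAdd.1).eq
        simp only [mul_assoc]
        rw [← mul_assoc (t ^ _) (u ^ _), this]
        simp only [mul_assoc] }
  refine ⟨(MulEquiv.ofBijective F ⟨?_, fun g => ?_⟩).symm⟩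
  · refine (injective_iff_map_eq_one F).2 fun x hx => ?_
    have := hinj _ _ hx
    exact Multiplicative.toAdd.injective (Prod.ext this.1 this.2)
  · obtain ⟨i, j, h⟩ := hsurj g
    exact ⟨Multiplicative.ofAdd (i, j), h⟩

theorem nonempty_mulEquiv_kleinBottleGroup (hut : t * u * t⁻¹ = u⁻¹)
    (hsurj : ∀ g : G, ∃ i j : ℤ, u ^ i * t ^ j = g)
    (hinj : ∀ i j : ℤ, u ^ i * t ^ j = 1 → i = 0 ∧ j = 0) :
    Nonempty (G ≃* KleinBottleGroup) := by
  have h1 : ∀ x : Multiplicative ℤ, zpowersHom G u x⁻¹ = t * zpowersHom G u x * t⁻¹ := by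
    intro x
    rw [zpowersHom_apply, zpowersHom_apply, ← conj_zpow, hut]
    simp
  have h2 : ∀ (n : ℤ) (x : Multiplicative ℤ),
      zpowersHom G u (((MulEquiv.inv (Multiplicative ℤ) : MulAut (Multiplicative ℤ)) ^ n) x) =
        t ^ n * zpowersHom G u x * (t ^ n)⁻¹ := by
    intro n
    induction n using Int.induction_on with
    | zero => simp
    | succ n ih =>
      intro x
      rw [zpow_add, zpow_one, MulAut.mul_apply, ih, MulEquiv.inv_apply, h1, zpow_add, zpow_one]
      group
    | pred n ih =>
      intro x
      have h3 : zpowersHom G u x⁻¹ = t⁻¹ * zpowersHom G u x * t := by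
        have := h1 x⁻¹
        rw [inv_inv] at this
        rw [this]
        group
      rw [zpow_sub, zpow_one, MulAut.mul_apply, ih, MulAut.inv_apply, MulEquiv.inv_symm,
        MulEquiv.inv_apply, h3, zpow_sub, zpow_one]
      group
  let F : KleinBottleGroup →* G := SemidirectProduct.lift (zpowersHom G u) (zpowersHom G t)
    (fun n => MonoidHom.ext fun x => h2 n.toAdd x)
  have hF : ∀ x, F x = u ^ x.left.toAdd * t ^ x.right.toAdd := fun x => rfl
  refine ⟨(MulEquiv.ofBijective F ⟨?_, fun g => ?_⟩).symm⟩
  · refine (injective_iff_map_eq_one F).2 fun x hx => ?_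
    have := hinj _ _ ((hF x).symm.trans hx)
    exact SemidirectProduct.ext (Multiplicative.toAdd.injective this.1)
      (Multiplicative.toAdd.injective this.2)
  · obtain ⟨i, j, h⟩ := hsurj g
    exact ⟨⟨Multiplicative.ofAdd i, Multiplicative.ofAdd j⟩, h⟩

theorem isElementaryGBS_of_generators (hut : t * u * t⁻¹ = u ∨ t * u * t⁻¹ = u⁻¹)
    (hsurj : ∀ g : G, ∃ i j : ℤ, u ^ i * t ^ j = g)
    (hinj : ∀ i j : ℤ, u ^ i * t ^ j = 1 → i = 0 ∧ j = 0) : IsElementaryGBS G := by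
  rcases hut with h | h
  · exact Or.inr (Or.inl (nonempty_mulEquiv_int_prod_int h hsurj hinj))
  · exact Or.inr (Or.inr (nonempty_mulEquiv_kleinBottleGroup h hsurj hinj))

end Elementary

/-! ### Actions on a line force an elementary group -/

namespace MetricGTree

variable {G : Type u} [Group G] {T : MetricGTree G}

/-- A loxodromic element commensurable with all its conjugates translates along a line equal to
the whole tree. -/
theorem IsAxis.surjective_of_commensurated (hT : T.IsMinimal) {a : G} {L : ℕ} {f : ℤ → T.V}
    (hf : T.IsAxis a L f)
    (ha : ∀ g : G, ∃ k l : ℤ, k ≠ 0 ∧ l ≠ 0 ∧ g * a ^ k * g⁻¹ = a ^ l) :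
    Function.Surjective f := by
  have hLpos : (0 : ℤ) < L := by exact_mod_cast hf.pos
  have hdisp : ∀ (k : ℤ) i, (T.graph.dist (f i) (a ^ k • f i) : ℤ) = |k| * L := fun k i => by
    rw [hf.zpow_smul, hf.dist_eq, show i - (i + k * L) = -(k * L) by ring, abs_neg, abs_mul,
      Nat.abs_cast]
  refine IsMinimal.eq_univ (W := Set.range f) hT ⟨f 0, 0, rfl⟩ ?_ ?_
  · rintro h _ ⟨i, rfl⟩
    obtain ⟨k, l, hk, hl, hkl⟩ := ha h
    have e1 : ∀ v, T.graph.dist (h • v) (a ^ l • h • v) = T.graph.dist v (a ^ k • v) := fun v => by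
      rw [← hkl, ← mul_smul, inv_mul_cancel_right, mul_smul, graphDist_smul]
    obtain ⟨j, hj⟩ := hf.exists_projection (h • f i)
    obtain ⟨j', hj'⟩ := hf.exists_projection (h⁻¹ • f i)
    -- With `d`, `d'` the distances of `h • f i` and `h⁻¹ • f i` to the axis, these read `|k| * L =
    -- 2 * d + |l| * L` and `|l| * L = 2 * d' + |k| * L`, so `d = 0`.
    have d1 := (hf.graphDist_zpow_smul hj hl).2.2
    have d2 := (hf.graphDist_zpow_smul hj' hk).2.2
    rw [e1, hdisp] at d1
    rw [← e1, smul_inv_smul, hdisp] at d2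
    have : T.graph.dist (h • f i) (f j) = 0 := by omega
    exact ⟨j, ((T.isTree.connected.dist_eq_zero_iff).1 this).symm⟩
  · rintro _ ⟨i, rfl⟩ _ ⟨j, rfl⟩
    refine ⟨T.geodesic (f i) (f j), fun x hx => ?_⟩
    obtain ⟨k, hk⟩ := hf.exists_eq_of_between (T.dist_add_of_mem_segment hx)
    exact ⟨k, hk.symm⟩

namespace IsAxis

variable {a : G} {L : ℕ} {f : ℤ → T.V}

/-- A reflection centred at the midpoint of an edge would be an inversion, so the centre is a
vertex. -/
theorem translation_or_reflection (hf : T.IsAxis a L f) (hs : Function.Surjective f) (h : G) :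
    (∃ c, ∀ i, h • f i = f (i + c)) ∨ ∃ c, ∀ i, h • f i = f (2 * c - i) := by
  choose ρ hρ using fun i => hs (h • f i)
  have hd : ∀ i j, |ρ i - ρ j| = |i - j| := fun i j => by
    rw [← hf.dist_eq, hρ, hρ, graphDist_smul, hf.dist_eq]
  have h01 := hd 0 1
  have : ρ 1 = ρ 0 + 1 ∨ ρ 1 = ρ 0 - 1 := by
    rcases abs_cases (ρ 0 - ρ 1) with h | h <;> norm_num at h01 <;> omega
  rcases this with h1 | h1
  · refine Or.inl ⟨ρ 0, fun i => ?_⟩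
    rw [← hρ]
    congr 1
    have e0 := hd i 0
    have e1 := hd i 1
    rcases abs_cases (ρ i - ρ 0) with h | h <;> rcases abs_cases (ρ i - ρ 1) with h' | h' <;>
      rcases abs_cases (i - 0) with h'' | h'' <;> rcases abs_cases (i - 1) with h''' | h''' <;>
      omega
  · have hr : ∀ i, h • f i = f (ρ 0 - i) := by
      intro i
      rw [← hρ]
      congr 1
      have e0 := hd i 0
      have e1 := hd i 1
      rcases abs_cases (ρ i - ρ 0) with h | h <;> rcases abs_cases (ρ i - ρ 1) with h' | h' <;>
        rcases abs_cases (i - 0) with h'' | h'' <;> rcases abs_cases (i - 1) with h''' | h''' <;>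
        omega
    rcases Int.even_or_odd' (ρ 0) with ⟨c, hc | hc⟩
    · exact Or.inr ⟨c, hc ▸ hr⟩
    · exfalso
      refine T.no_inversion h (f c) (f (c + 1)) ?_ ⟨?_, ?_⟩
      · rw [← SimpleGraph.dist_eq_one_iff_adj]
        zify
        rw [hf.dist_eq]
        norm_num
      · rw [hr]; congr 1; omega
      · rw [hr]; congr 1; omega

theorem exists_translation_generator (hf : T.IsAxis a L f) :
    ∃ m : ℤ, m ≠ 0 ∧ (∃ τ : G, ∀ i, τ • f i = f (i + m)) ∧
      ∀ (h : G) (c : ℤ), (∀ i, h • f i = f (i + c)) → ∃ j, c = j * m := by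
  let C : AddSubgroup ℤ :=
    { carrier := {c | ∃ h : G, ∀ i, h • f i = f (i + c)}
      zero_mem' := ⟨1, by simp⟩
      add_mem' := by
        rintro c d ⟨g, hg⟩ ⟨h, hh⟩
        exact ⟨h * g, fun i => by rw [mul_smul, hg, hh, add_assoc]⟩
      neg_mem' := by
        rintro c ⟨h, hh⟩
        exact ⟨h⁻¹, fun i => by rw [inv_smul_eq_iff, hh, neg_add_cancel_right]⟩ }
  obtain ⟨m, hm⟩ := Int.subgroup_cyclic C
  have hmem : ∀ c ∈ C, ∃ j, c = j * m := fun c hc => by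
    rw [hm, AddSubgroup.mem_closure_singleton] at hc
    obtain ⟨j, hj⟩ := hc
    exact ⟨j, by rw [← hj, smul_eq_mul]⟩
  refine ⟨m, ?_, ?_, fun h c hc => hmem c ⟨h, hc⟩⟩
  · rintro rfl
    obtain ⟨j, hj⟩ := hmem L ⟨a, hf.smul_eq⟩
    have := hf.pos
    omega
  · have : m ∈ C := by rw [hm]; exact AddSubgroup.mem_closure_singleton_self m
    exact this

theorem shift (hf : T.IsAxis a L f) (c : ℤ) : T.IsAxis a L fun i => f (i + c) where
  pos := hf.pos
  dist_eq i j := by rw [hf.dist_eq]; congr 1; ring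
  smul_eq i := by rw [hf.smul_eq]; congr 1; ring

variable {e : G}

/-- The stabilizer of `f 0` is the kernel of the action: an infinite cyclic normal subgroup with
infinite cyclic quotient, so `t` conjugates its generator `u` to `u` or `u⁻¹`. -/
theorem isElementaryGBS_of_translations (hT : T.IsCommensuratedBy e) (hf : T.IsAxis a L f)
    (h : ∀ g : G, ∃ c, ∀ i, g • f i = f (i + c)) : IsElementaryGBS G := by
  obtain ⟨m, hm, ⟨t, ht⟩, hgen⟩ := hf.exists_translation_generator
  obtain ⟨u, hu, hugen⟩ := exists_stabilizer_generator hT.isCyclic (f 0)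
  have hu1 : ∀ n : ℤ, u ^ n = 1 → n = 0 := hT.eq_zero_of_zpow_eq_one hugen
  have htriv : ∀ g : G, g • f 0 = f 0 → ∀ i, g • f i = f i := by
    intro g hg i
    obtain ⟨c, hc⟩ := h g
    have := hf.injective ((hc 0).symm.trans hg)
    rw [hc]
    congr 1
    omega
  have hconj : ∀ g : G, ∃ n : ℤ, u ^ n = g * u * g⁻¹ := fun g => hugen _ (by
    obtain ⟨c, hc⟩ := h g⁻¹
    rw [mul_smul, mul_smul, hc, htriv u hu, ← hc, smul_inv_smul])
  refine isElementaryGBS_of_generators (u := u) (t := t) ?_ ?_ ?_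
  · obtain ⟨n, hn⟩ := hconj t
    obtain ⟨k, hk⟩ := hconj t⁻¹
    have e1 : u ^ (n * k - 1) = 1 := by
      rw [zpow_sub, mul_comm n, zpow_mul, hk, conj_zpow, hn]
      group
    have e2 := hu1 _ e1
    rcases Int.eq_one_or_neg_one_of_mul_eq_one (show n * k = 1 by omega) with rfl | rfl
    · exact Or.inl (by rw [← hn, zpow_one])
    · exact Or.inr (by rw [← hn, zpow_neg_one])
  · intro g
    obtain ⟨c, hc⟩ := h g
    obtain ⟨j, rfl⟩ := hgen g c hc
    obtain ⟨i, hi⟩ := hugen (g * t ^ (-j)) (by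
      rw [mul_smul, zpow_smul_of_translation ht, hc]; congr 1; ring)
    exact ⟨i, j, by rw [hi, mul_assoc, ← zpow_add, neg_add_cancel, zpow_zero, mul_one]⟩
  · intro i j hij
    have h1 : (u ^ i * t ^ j) • f 0 = f (0 + j * m) := by
      rw [mul_smul, zpow_smul_of_translation ht]
      exact htriv _ ((MulAction.stabilizer G (f 0)).zpow_mem hu i) _
    rw [hij, one_smul] at h1
    have h2 := hf.injective h1
    have hj : j = 0 := by
      have : j * m = 0 := by omega
      exact (mul_eq_zero.1 this).resolve_right hm
    subst hj
    exact ⟨hu1 i (by simpa using hij), rfl⟩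

/-- If some element reflects the line at a vertex, then the generator of the stabilizer of this
vertex also does, and its square generates the kernel of the action. -/
theorem exists_reflection_generator (hT : T.IsCommensuratedBy e) (hf : T.IsAxis a L f)
    (hs : Function.Surjective f) {r : G} {c : ℤ} (hr : ∀ i, r • f i = f (2 * c - i)) :
    ∃ t : G, (∀ i, t • f i = f (2 * c - i)) ∧ (∀ n : ℤ, t ^ n = 1 → n = 0) ∧
      ∀ g : G, (∀ i, g • f i = f i) → ∃ n : ℤ, (t ^ 2) ^ n = g := by
  obtain ⟨t, ht, htgen⟩ := exists_stabilizer_generator hT.isCyclic (f c)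
  have ht' : ∀ i, t • f i = f (2 * c - i) := by
    rcases hf.translation_or_reflection hs t with ⟨d, hd⟩ | ⟨d, hd⟩
    -- A translation fixing `f c` is trivial, but the reflection `r` is a power of `t`.
    · exfalso
      have hd0 := hf.injective ((hd c).symm.trans ht)
      obtain ⟨n, hn⟩ := htgen r (by rw [hr]; congr 1; ring)
      have h1 := zpow_smul_of_translation hd n (c + 1)
      rw [hn, hr] at h1
      have := hf.injective h1
      have hd00 : d = 0 := by omega
      rw [hd00] at this
      omega
    · have hd0 := hf.injective ((hd c).symm.trans ht)
      have : d = c := by omega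
      exact this ▸ hd
  refine ⟨t, ht', hT.eq_zero_of_zpow_eq_one htgen, fun g hg => ?_⟩
  obtain ⟨n, hn⟩ := htgen g (hg c)
  have ht2 : ∀ i, (t ^ 2) • f i = f (i + 0) := fun i => by
    rw [pow_two, mul_smul, ht', ht']; congr 1; ring
  rcases Int.even_or_odd' n with ⟨k, rfl | rfl⟩
  · exact ⟨k, by rw [← hn, zpow_mul]; norm_cast⟩
  · exfalso
    have h1 := hg (c + 1)
    rw [← hn, zpow_add, zpow_mul, zpow_one, mul_smul, ht',
      show t ^ (2 : ℤ) = t ^ 2 by norm_cast, zpow_smul_of_translation ht2] at h1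
    have := hf.injective h1
    omega

/-- The action is infinite dihedral. Generators `t`, `b` of the stabilizers of two reflection
centres have squares generating the same kernel; replacing `b` by its inverse if needed gives `b'`
with `b' * b' = t * t`, and then `t` inverts the translation `t * b'⁻¹`. -/
theorem isElementaryGBS_of_reflection (hT : T.IsCommensuratedBy e) (hf : T.IsAxis a L f)
    (hs : Function.Surjective f) {r : G} (hr : ∀ i, r • f i = f (-i)) : IsElementaryGBS G := by
  obtain ⟨m, hm, ⟨τ, hτ⟩, hgen⟩ := hf.exists_translation_generator
  obtain ⟨t, ht, ht1, htgen⟩ := exists_reflection_generator hT hf hs (r := r) (c := 0)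
    (fun i => by rw [hr]; congr 1; ring)
  have htτ : ∀ i, (t * τ) • f i = f (-m - i) := fun i => by
    rw [mul_smul, hτ, ht]; congr 1; ring
  obtain ⟨c, hc⟩ : ∃ c, ∀ i, (t * τ) • f i = f (2 * c - i) := by
    rcases hf.translation_or_reflection hs (t * τ) with ⟨d, hd⟩ | h
    · exfalso
      have h0 := hf.injective ((hd 0).symm.trans (htτ 0))
      have h1 := hf.injective ((hd 1).symm.trans (htτ 1))
      omega
    · exact h
  have hcm : 2 * c = -m := by
    have := hf.injective ((hc 0).symm.trans (htτ 0))
    omega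
  obtain ⟨b, hb, hb1, hbgen⟩ := exists_reflection_generator hT hf hs hc
  obtain ⟨j, hj⟩ := hbgen (t ^ 2) fun i => by rw [pow_two, mul_smul, ht, ht]; congr 1; ring
  obtain ⟨k, hk⟩ := htgen (b ^ 2) fun i => by rw [pow_two, mul_smul, hb, hb]; congr 1; ring
  have hjk : k * j = 1 := by
    have : t ^ (2 * (k * j) - 2) = 1 := by
      rw [zpow_sub, zpow_mul, show t ^ (2 : ℤ) = t ^ 2 by norm_cast, zpow_mul, hk, hj,
        mul_inv_cancel]
    have := ht1 _ this
    omega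
  obtain ⟨b', hb', hbt⟩ : ∃ b' : G, (∀ i, b' • f i = f (-m - i)) ∧ b' * b' = t * t := by
    rw [mul_comm] at hjk
    rcases Int.eq_one_or_neg_one_of_mul_eq_one hjk with rfl | rfl
    · exact ⟨b, fun i => by rw [hb, hcm], by rw [← pow_two, ← pow_two, ← hj, zpow_one]⟩
    · refine ⟨b⁻¹, fun i => ?_, ?_⟩
      · rw [inv_smul_eq_iff, hb]; congr 1; omega
      · rw [← pow_two t, ← hj]; group
  have hu : ∀ i, (t * b'⁻¹) • f i = f (i + m) := fun i => by
    rw [mul_smul]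
    have : b'⁻¹ • f i = f (-m - i) := by rw [inv_smul_eq_iff, hb']; congr 1; ring
    rw [this, ht]; congr 1; ring
  have htrans : ∀ (g : G) (c : ℤ), (∀ i, g • f i = f (i + c)) →
      ∃ i j : ℤ, (t * b'⁻¹) ^ i * t ^ j = g := by
    intro g c hg
    obtain ⟨i, rfl⟩ := hgen g c hg
    obtain ⟨n, hn⟩ := htgen ((t * b'⁻¹) ^ (-i) * g) fun k => by
      rw [mul_smul, hg, zpow_smul_of_translation hu]; congr 1; ring
    refine ⟨i, 2 * n, ?_⟩
    rw [zpow_mul, show t ^ (2 : ℤ) = t ^ 2 by norm_cast, hn, ← mul_assoc, ← zpow_add,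
      add_neg_cancel, zpow_zero, one_mul]
  refine isElementaryGBS_of_generators (u := t * b'⁻¹) (t := t) (Or.inr ?_) (fun g => ?_) ?_
  · calc t * (t * b'⁻¹) * t⁻¹ = t * t * b'⁻¹ * t⁻¹ := by group
      _ = (t * b'⁻¹)⁻¹ := by rw [← hbt]; group
  · rcases hf.translation_or_reflection hs g with ⟨c, hc⟩ | ⟨c, hc⟩
    · exact htrans g c hc
    · obtain ⟨i, j, hij⟩ := htrans (g * t) (2 * c) fun i => by
        rw [mul_smul, ht, hc]; congr 1; ring
      exact ⟨i, j - 1, by rw [zpow_sub_one, ← mul_assoc, hij, mul_inv_cancel_right]⟩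
  · intro i j hij
    have h0 : t ^ j • f 0 = f 0 :=
      (MulAction.stabilizer G (f 0)).zpow_mem (show t • f 0 = f 0 by rw [ht]; congr 1) j
    have h1 : ((t * b'⁻¹) ^ i * t ^ j) • f 0 = f (0 + i * m) := by
      rw [mul_smul, h0, zpow_smul_of_translation hu]
    rw [hij, one_smul] at h1
    have h2 := hf.injective h1
    have hi : i = 0 := by
      have : i * m = 0 := by omega
      exact (mul_eq_zero.1 this).resolve_right hm
    subst hi
    exact ⟨rfl, ht1 j (by simpa using hij)⟩

end IsAxis

/-- In a non-elementary GBS group, an element commensurable with all its conjugates is elliptic. -/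
theorem IsCommensuratedBy.exists_smul_eq {e : G} (hG : ¬ IsElementaryGBS G)
    (hT : T.IsCommensuratedBy e) {a : G}
    (ha : ∀ g : G, ∃ k l : ℤ, k ≠ 0 ∧ l ≠ 0 ∧ g * a ^ k * g⁻¹ = a ^ l) : ∃ v : T.V, a • v = v := by
  by_contra! hlox
  obtain ⟨L, f, hf⟩ := IsLoxodromic.exists_isAxis (T := T) hlox
  have hs := hf.surjective_of_commensurated hT.minimal ha
  by_cases h : ∀ g : G, ∃ c, ∀ i, g • f i = f (i + c)
  · exact hG (IsAxis.isElementaryGBS_of_translations hT hf h)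
  · push Not at h
    obtain ⟨r, hr⟩ := h
    rcases hf.translation_or_reflection hs r with ⟨c, hc⟩ | ⟨c, hc⟩
    · obtain ⟨i, hi⟩ := hr c
      exact hi (hc i)
    · refine hG (IsAxis.isElementaryGBS_of_reflection hT (hf.shift c) (fun v => ?_) (r := r)
        fun i => ?_)
      · obtain ⟨i, hi⟩ := hs v
        exact ⟨i - c, by simpa using hi⟩
      · simp only [hc]; congr 1; ring

end MetricGTree

/-! ### Twisting by automorphisms, and the proof of the equivalences -/

namespace MetricGTree

variable {G : Type u} [Group G] {T T₀ : MetricGTree G} {e : G}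

/-- The tree obtained from `T` by precomposing the action with the automorphism `θ`. -/
def twist (T : MetricGTree G) (θ : MulAut G) : MetricGTree G where
  V := T.V
  action := MulAction.compHom T.V θ.toMonoidHom
  graph := T.graph
  isTree := T.isTree
  adj_smul g := T.adj_smul (θ g)
  no_inversion g := T.no_inversion (θ g)
  len := T.len
  len_pos := T.len_pos
  len_symm := T.len_symm
  len_smul g := T.len_smul (θ g)

theorem isElliptic_twist {θ : MulAut G} {H : Subgroup G} :
    (T.twist θ).IsElliptic H ↔ T.IsElliptic (H.map θ.toMonoidHom) := by
  constructor
  · rintro ⟨v, hv⟩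
    refine ⟨v, ?_⟩
    rintro _ ⟨h, hh, rfl⟩
    exact hv h hh
  · rintro ⟨v, hv⟩
    exact ⟨v, fun h hh => hv _ ⟨h, hh, rfl⟩⟩

theorem IsMinimal.twist (hT : T.IsMinimal) (θ : MulAut G) : (T.twist θ).IsMinimal := by
  intro W hne hinv hW
  refine hT W hne (fun g v hv => ?_) hW
  have : θ (θ⁻¹ g) • v ∈ W := hinv (θ⁻¹ g) v hv
  rwa [MulAut.apply_inv_self] at this

theorem ShareFundamentalDomains.of_twist {θ : MulAut G} {N : ℕ} {a b : G}
    (h : (T.twist θ).ShareFundamentalDomains N a b) :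
    T.ShareFundamentalDomains N (θ a) (θ b) := by
  obtain ⟨h, v, h1, h2, h3⟩ := shareFundamentalDomains_iff.1 h
  have h2' : v ∈ T.axis (θ (h * b * h⁻¹)) := h2
  have h3' : θ (a ^ N) • (show T.V from v) = θ ((h * b * h⁻¹) ^ N) • (show T.V from v) := h3
  rw [map_mul, map_mul, map_inv] at h2'
  rw [map_pow, map_pow, map_mul, map_mul, map_inv] at h3'
  exact shareFundamentalDomains_iff.2 ⟨θ h, v, h1, h2', h3'⟩

theorem isElliptic_zpowers_iff {a : G} :
    T.IsElliptic (Subgroup.zpowers a) ↔ ∃ v : T.V, a • v = v := by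
  refine exists_congr fun v => ⟨fun h => h a (Subgroup.mem_zpowers a), fun h g hg => ?_⟩
  obtain ⟨n, rfl⟩ := Subgroup.mem_zpowers_iff.1 hg
  exact (MulAction.stabilizer G v).zpow_mem h n

theorem isLoxodromic_iff_not_isElliptic {a : G} :
    T.IsLoxodromic a ↔ ¬ T.IsElliptic (Subgroup.zpowers a) := by
  rw [isElliptic_zpowers_iff, not_exists]
  rfl

/-- The automorphisms of a non-elementary GBS group preserve ellipticity. -/
theorem IsCommensuratedBy.isElliptic_map (hG : ¬ IsElementaryGBS G) (hT : T.IsCommensuratedBy e)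
    {H : Subgroup G} (hH : T.IsElliptic H) (θ : MulAut G) :
    T.IsElliptic (H.map θ.toMonoidHom) := by
  obtain ⟨v, hv⟩ := hH
  obtain ⟨x, hx, hgen⟩ := exists_stabilizer_generator hT.isCyclic v
  -- Commensurability with all conjugates passes from `x` to `θ x`, so `θ x` is elliptic.
  obtain ⟨w, hw⟩ := hT.exists_smul_eq hG (a := θ x) fun g => by
    obtain ⟨k, l, hk, hl, hkl⟩ := hT.exists_conj_zpow_eq hx (θ⁻¹ g)
    refine ⟨k, l, hk, hl, ?_⟩
    have := congrArg θ hkl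
    rwa [map_mul, map_mul, map_inv, map_zpow, map_zpow, MulAut.apply_inv_self] at this
  refine ⟨w, ?_⟩
  rintro _ ⟨h, hh, rfl⟩
  obtain ⟨n, rfl⟩ := hgen h (hv h hh)
  rw [map_zpow]
  exact (MulAction.stabilizer G w).zpow_mem hw n

theorem IsCommensuratedBy.isElliptic_map_iff (hG : ¬ IsElementaryGBS G)
    (hT : T.IsCommensuratedBy e) (H : Subgroup G) (θ : MulAut G) :
    T.IsElliptic (H.map θ.toMonoidHom) ↔ T.IsElliptic H := by
  refine ⟨fun h => ?_, fun h => hT.isElliptic_map hG h θ⟩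
  have := hT.isElliptic_map hG h θ⁻¹
  have hid : (H.map θ.toMonoidHom).map (θ⁻¹ : MulAut G).toMonoidHom = H := by
    rw [Subgroup.map_map]
    convert Subgroup.map_id H
    ext x
    exact MulAut.inv_apply_self G θ x
  rwa [hid] at this

theorem IsCommensuratedBy.isLoxodromic_map (hG : ¬ IsElementaryGBS G)
    (hT : T.IsCommensuratedBy e) {a : G} (ha : T.IsLoxodromic a) (θ : MulAut G) :
    T.IsLoxodromic (θ a) := by
  rw [isLoxodromic_iff_not_isElliptic] at *
  rw [← hT.isElliptic_map_iff hG _ θ, MonoidHom.map_zpowers] at ha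
  exact ha

theorem IsCommensuratedBy.twist_mem_deformationSpace (hG : ¬ IsElementaryGBS G)
    (hT₀ : T₀.IsCommensuratedBy e) (hT : T ∈ T₀.deformationSpace) (θ : MulAut G) :
    T.twist θ ∈ T₀.deformationSpace :=
  ⟨hT.1.twist θ, fun H => by rw [isElliptic_twist, hT.2, hT₀.isElliptic_map_iff hG]⟩

theorem isLoxodromic_iff_of_mem_deformationSpace (hT : T ∈ T₀.deformationSpace) {a : G} :
    T.IsLoxodromic a ↔ T₀.IsLoxodromic a := by
  rw [isLoxodromic_iff_not_isElliptic, isLoxodromic_iff_not_isElliptic, hT.2]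

variable {g : G} {φ : MulAut G}

/-- If two iterates of `g` share at least two fundamental domains in one tree of the deformation
space, then `g` and some positive iterate do so in all of them. -/
theorem IsCommensuratedBy.exists_forall_share (hG : ¬ IsElementaryGBS G)
    (hT₀ : T₀.IsCommensuratedBy e) (hg : T₀.IsLoxodromic g) (hT : T ∈ T₀.deformationSpace)
    {N : ℕ} (hN : 2 ≤ N) {n m : ℤ} (hnm : n ≠ m)
    (h : T.ShareFundamentalDomains N ((φ ^ n) g) ((φ ^ m) g)) :
    ∃ p : ℕ, 0 < p ∧ ∀ S ∈ T₀.deformationSpace, S.ShareFundamentalDomains N g ((φ ^ p) g) := by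
  wlog hlt : n < m generalizing n m
  · exact this hnm.symm h.symm (by omega)
  refine ⟨(m - n).toNat, by omega, fun S hS => ?_⟩
  -- In this twist `(φ ^ n) g` acts as `g` does on `S`, and `(φ ^ m) g` as `(φ ^ (m - n)) g` does.
  have hS' := hT₀.twist_mem_deformationSpace hG hS (φ ^ (-n))
  have lox := fun k : ℤ => hT₀.isLoxodromic_map hG hg (φ ^ k)
  have h1 := (h.of_isElliptic (S := S.twist (φ ^ (-n))) (fun H hH => (hS'.2 H).2 ((hT.2 H).1 hH))
    ((isLoxodromic_iff_of_mem_deformationSpace hT).2 (lox n))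
    ((isLoxodromic_iff_of_mem_deformationSpace hT).2 (lox m))
    ((isLoxodromic_iff_of_mem_deformationSpace hS').2 (lox n))
    ((isLoxodromic_iff_of_mem_deformationSpace hS').2 (lox m)) hN).of_twist
  rw [← MulAut.mul_apply, ← MulAut.mul_apply, ← zpow_add, ← zpow_add, neg_add_cancel, zpow_zero,
    MulAut.one_apply] at h1
  rwa [← zpow_natCast, show (((m - n).toNat : ℕ) : ℤ) = -n + m by omega]

/-- The factor `s` covers forward iterates (`s = 1`) and backward ones (`s = -1`) at once. -/
theorem IsCommensuratedBy.exists_forall_share_of_bounded [Group.FG G] (hG : ¬ IsElementaryGBS G)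
    (hT₀ : T₀.IsCommensuratedBy e) (he : ∃ v : T₀.V, e • v = v) (hg : T₀.IsLoxodromic g)
    (hT : T ∈ T₀.deformationSpace) {s : ℤ} (hs : s ≠ 0) {B : ℝ}
    (hB : ∀ n : ℕ, T.translationLength ((φ ^ (s * n)) g) ≤ B) {N : ℕ} (hN : 2 ≤ N) :
    ∃ p : ℕ, 0 < p ∧ ∀ S ∈ T₀.deformationSpace, S.ShareFundamentalDomains N g ((φ ^ p) g) := by
  obtain ⟨n, m, hnm, h⟩ := (hT₀.of_mem_deformationSpace he hT).exists_shareFundamentalDomains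
    (fun n : ℕ => (φ ^ (s * n)) g)
    (fun n => (isLoxodromic_iff_of_mem_deformationSpace hT).2 (hT₀.isLoxodromic_map hG hg _)) hB N
  refine hT₀.exists_forall_share hG hg hT hN ?_ h
  intro h'
  exact hnm (by exact_mod_cast mul_left_cancel₀ hs h')

/-- Sharing a domain equates translation lengths; in the twist of `T` by `φ ^ k` this says that the
lengths at `k` and `k + p` agree. -/
theorem IsCommensuratedBy.bounded_of_forall_share (hG : ¬ IsElementaryGBS G)
    (hT₀ : T₀.IsCommensuratedBy e) (hg : T₀.IsLoxodromic g) {N p : ℕ} (hN : 1 ≤ N) (hp : 0 < p)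
    (h : ∀ S ∈ T₀.deformationSpace, S.ShareFundamentalDomains N g ((φ ^ p) g))
    (hT : T ∈ T₀.deformationSpace) :
    ∃ B : ℝ, ∀ k : ℤ, T.translationLength ((φ ^ k) g) ≤ B := by
  have hper : Function.Periodic (fun k : ℤ => T.translationLength ((φ ^ k) g)) p := by
    intro k
    have hS := hT₀.twist_mem_deformationSpace hG hT (φ ^ k)
    have := ShareFundamentalDomains.translationLength_eq hN
      ((isLoxodromic_iff_of_mem_deformationSpace hS).2 hg)
      ((isLoxodromic_iff_of_mem_deformationSpace hS).2 (hT₀.isLoxodromic_map hG hg (φ ^ p)))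
      (h _ hS)
    show T.translationLength ((φ ^ (k + p : ℤ)) g) = _
    rw [zpow_add, MulAut.mul_apply, zpow_natCast]
    exact this.symm
  obtain ⟨B, hB⟩ := ((Set.finite_Ico (0 : ℤ) p).image
    fun k : ℤ => T.translationLength ((φ ^ k) g)).bddAbove
  refine ⟨B, fun k => hB ⟨k % p, ⟨Int.emod_nonneg _ (by omega), Int.emod_lt_of_pos _ (by omega)⟩,
    ?_⟩⟩
  have := hper.int_mul (k / p) (k % p)
  rw [Int.cast_id, mul_comm, Int.emod_add_mul_ediv] at this
  exact this.symm

/-- Changing the representative of the outer class changes each iterate only by conjugation, so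
translation lengths are unaffected. -/
theorem isConj_pow_of_mk_eq {ψ : MulAut G} {a : G}
    (hψ : (QuotientGroup.mk ψ : OutClasses G) = QuotientGroup.mk φ) (ha : IsConj g a) (n : ℕ) :
    IsConj ((φ ^ n) g) ((ψ ^ n) a) := by
  obtain ⟨k, hk⟩ := QuotientGroup.eq.1 hψ
  have hφ : φ = ψ * MulAut.conj k := by rw [hk, mul_inv_cancel_left]
  induction n with
  | zero => exact ha
  | succ n ih =>
    rw [pow_succ', pow_succ', MulAut.mul_apply, MulAut.mul_apply]
    nth_rewrite 1 [hφ]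
    rw [MulAut.mul_apply, MulAut.conj_apply]
    refine ψ.toMonoidHom.map_isConj (IsConj.trans ?_ ih)
    exact (isConj_iff.2 ⟨k, rfl⟩).symm

theorem translationLength_eq_of_isConj {a b : G} (h : IsConj a b) :
    T.translationLength a = T.translationLength b := by
  obtain ⟨c, rfl⟩ := isConj_iff.1 h
  exact (T.translationLength_conj c a).symm

end MetricGTree

theorem mainTheorem2 {G : Type u} [Group G] [Group.FG G]
    (hG : ¬ IsElementaryGBS G)
    (T₀ : MetricGTree G) (hT₀ : T₀.IsGBSTree)
    (φ : MulAut G) (g : G) (hg : T₀.IsLoxodromic g) :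
    List.TFAE [
      MetricGTree.IsPseudoPeriodic T₀.deformationSpace
        (QuotientGroup.mk φ : OutClasses G) (ConjClasses.mk g),
      ∀ T ∈ T₀.deformationSpace, ∀ N : ℕ, 1 ≤ N →
        ∃ n m : ℕ, n ≠ m ∧ T.ShareFundamentalDomains N ((φ ^ n) g) ((φ ^ m) g),
      ∀ N : ℕ, 1 ≤ N → ∃ m : ℕ, 0 < m ∧
        ∀ S ∈ T₀.deformationSpace, S.ShareFundamentalDomains N g ((φ ^ m) g),
      ∀ T ∈ T₀.deformationSpace,
        ∃ B : ℝ, ∀ n : ℕ, T.translationLength ((φ ^ (-(n : ℤ))) g) ≤ B] := by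
  obtain ⟨e, hT₀e, he⟩ := hT₀.exists_isCommensuratedBy
  have hmem : T₀ ∈ T₀.deformationSpace := ⟨hT₀.1, fun H => Iff.rfl⟩
  -- Rigidity needs at least two domains, so `N` domains, in particular one, are obtained from `N +
  -- 1`.
  have mono : ∀ N : ℕ, (∃ p : ℕ, 0 < p ∧ ∀ S ∈ T₀.deformationSpace,
      S.ShareFundamentalDomains (N + 1) g ((φ ^ p) g)) → ∃ p : ℕ, 0 < p ∧
      ∀ S ∈ T₀.deformationSpace, S.ShareFundamentalDomains N g ((φ ^ p) g) := by
    rintro N ⟨p, hp, h⟩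
    exact ⟨p, hp, fun S hS => (h S hS).mono N.le_succ N.succ_pos
      ((MetricGTree.isLoxodromic_iff_of_mem_deformationSpace hS).2 hg)
      ((MetricGTree.isLoxodromic_iff_of_mem_deformationSpace hS).2
        (hT₀e.isLoxodromic_map hG hg _))⟩
  have bdd : (∀ N : ℕ, 1 ≤ N → ∃ m : ℕ, 0 < m ∧
      ∀ S ∈ T₀.deformationSpace, S.ShareFundamentalDomains N g ((φ ^ m) g)) →
      ∀ T ∈ T₀.deformationSpace, ∃ B : ℝ, ∀ k : ℤ, T.translationLength ((φ ^ k) g) ≤ B := by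
    intro h T hT
    obtain ⟨p, hp, hs⟩ := h 1 le_rfl
    exact hT₀e.bounded_of_forall_share hG hg le_rfl hp hs hT
  tfae_have 1 → 3 := by
    rintro ⟨T, hT, ψ, hψ, a, ha, B, hB⟩ N hN
    refine mono N (hT₀e.exists_forall_share_of_bounded hG he hg hT one_ne_zero (B := B)
      (fun n => ?_) (by omega))
    rw [one_mul, zpow_natCast, MetricGTree.translationLength_eq_of_isConj
      (MetricGTree.isConj_pow_of_mk_eq hψ (ConjClasses.mk_eq_mk_iff_isConj.1 ha.symm) n)]
    exact hB n
  tfae_have 4 → 3 := by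
    intro h N hN
    obtain ⟨B, hB⟩ := h T₀ hmem
    exact mono N (hT₀e.exists_forall_share_of_bounded hG he hg hmem (s := -1) (by norm_num)
      (B := B) (fun n => by rw [neg_one_mul]; exact hB n) (by omega))
  tfae_have 2 → 3 := by
    intro h N hN
    obtain ⟨n, m, hnm, hs⟩ := h T₀ hmem (N + 1) (by omega)
    exact mono N (hT₀e.exists_forall_share hG hg hmem (n := n) (m := m) (by omega)
      (by exact_mod_cast hnm) (by simpa only [zpow_natCast] using hs))
  tfae_have 3 → 2 := by
    intro h T hT N hN
    obtain ⟨p, hp, hs⟩ := h N hN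
    exact ⟨0, p, hp.ne, by simpa using hs T hT⟩
  tfae_have 3 → 1 := by
    intro h
    obtain ⟨B, hB⟩ := bdd h T₀ hmem
    exact ⟨T₀, hmem, φ, rfl, g, rfl, B, fun n => by simpa using hB n⟩
  tfae_have 3 → 4 := by
    intro h T hT
    obtain ⟨B, hB⟩ := bdd h T hT
    exact ⟨B, fun n => hB _⟩
  tfae_finish
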